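/- Let $\mathbb R^{2,1}$ be $\mathbb R^3$ with the form $\langle v,w\rangle=v_1w_1+v_2w_2-v_3w_3$ and let $\mathbb H^2=\{v\in\mathbb R^{2,1}:\langle v,v\rangle=-1,\ v_3>0\}$ be the hyperbolic plane with the induced metric. Let $(S,h)$ be a connected oriented hyperbolic surface (possibly open and non-complete), with universal covering $p:\tilde S\to S$, developing map $\mathrm{dev}:\tilde S\to\mathbb H^2$ (a local isometry for the metric lifted from $h$) and holonomy $\mathrm{hol}:\pi_1(S)\to \mathrm{SO}_0(2,1)$, so that $\mathrm{dev}\circ\alpha=\mathrm{hol}(\alpha)\circ\mathrm{dev}$ for every deck transformation $\alpha\in\pi_1(S)$. Let $F=(\tilde S\times\mathbb R^{2,1})/\pi_1(S)$ be the associated flat bundle over $S$, where $\pi_1(S)$ acts by $\alpha\cdot(x,v)=(\alpha x,\mathrm{hol}(\alpha)v)$. Its fibres carry the Minkowski product $\langle\cdot,\cdot\rangle$, and $\mathrm{dev}$ induces the developing section $\iota:S\to F$, $\iota(p(x))=[x,\mathrm{dev}(x)]$. On $S$ consider the following sheaves of abelian groups: - $\mathcal F$, the sheaf of flat sections of $F$;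 - $\mathrm C^\infty$, the sheaf of smooth real functions; - $\mathcal C$, the sheaf of smooth $h$-self-adjoint operators $b:TS\to TS$ which satisfy the Codazzi equation $d^\nabla b=0$, that is, $\nabla_X(bY)-\nabla_Y(bX)-b[X,Y]=0$ for all vector fields $X,Y$, where $\nabla$ is the Levi-Civita connection of $h$. Then $V(\sigma)=\langle\sigma,\iota\rangle$ and $H(u)=\mathrm{Hess}\,u-u\,\mathrm I$, where $\mathrm{Hess}\,u=\nabla\operatorname{grad}u$ is regarded as an operator on $TS$ and $\mathrm I$ is the identity, define morphisms of sheaves $V:\mathcal F\to \mathrm C^\infty$ and $H:\mathrm C^\infty\to\mathcal C$, and the sequence of sheaves $$0\longrightarrow\mathcal F\xrightarrow{\;V\;}\mathrm C^\infty\xrightarrow{\;H\;}\mathcal C\longrightarrow 0$$ is exact. Moreover, if $U$ is a non-empty open (geodesically) convex subset of $\mathbb H^2$, then the smooth functions $u$ on $U$ with $H(u)=0$ are exactly the functions $u(x)=\langle t,x\rangle$ with $t\in\mathbb R^{2,1}$; the vector $t$ is uniquely determined by $u$, and these functions form a real vector space of dimension $3$. -/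

import Mathlib

open scoped Manifold ContDiff Topology
open CategoryTheory TopologicalSpace

universe u w

noncomputable section

namespace HypSurf

/-! ### Sheaves of sections of a family of abelian groups -/

/-- A condition on sections of a family `T` of abelian groups over a space `X` which is local and
stable under the group operations. -/
structure LocalCondition {X : Type u} [TopologicalSpace X] (T : X → Type w)
    [∀ x, AddCommGroup (T x)] where
  pred : ∀ U : Opens X, (∀ x : U, T x) → Prop
  res : ∀ {U V : Opens X} (i : U ≤ V) (f : ∀ x : V, T x), pred V f → pred U fun x => f ⟨x, i x.2⟩
  locality : ∀ {U : Opens X} (f : ∀ x : U, T x),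
    (∀ x ∈ U, ∃ (V : Opens X) (_ : x ∈ V) (i : V ≤ U), pred V fun x => f ⟨x, i x.2⟩) → pred U f
  zero : ∀ U : Opens X, pred U fun _ => 0
  add : ∀ {U : Opens X} {f g : ∀ x : U, T x}, pred U f → pred U g → pred U fun x => f x + g x
  neg : ∀ {U : Opens X} {f : ∀ x : U, T x}, pred U f → pred U fun x => - f x

namespace LocalCondition

variable {X : Type u} [TopologicalSpace X] {T : X → Type w}
    [∀ x, AddCommGroup (T x)] (P : LocalCondition T)

/-- The group of sections over `U` satisfying the condition. -/
def sections (U : Opens X) : AddSubgroup (∀ x : U, T x) where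
  carrier := {f | P.pred U f}
  zero_mem' := P.zero U
  add_mem' := P.add
  neg_mem' := P.neg

/-- The restriction of sections. -/
def restrict {U V : Opens X} (i : U ≤ V) : P.sections V →+ P.sections U where
  toFun f := ⟨fun x => f.1 ⟨x, i x.2⟩, P.res i f.1 f.2⟩
  map_zero' := rfl
  map_add' _ _ := rfl

/-- The presheaf of sections satisfying the condition. -/
def presheaf : TopCat.Presheaf AddCommGrpCat.{max u w} (TopCat.of X) where
  obj U := AddCommGrpCat.of (P.sections U.unop)
  map i := AddCommGrpCat.ofHom (P.restrict i.unop.le)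

/-- The underlying local predicate. -/
def toLocalPredicate : TopCat.LocalPredicate (X := TopCat.of X) T where
  pred {U} f := P.pred U f
  res i f h := P.res i.le f h
  locality f h := P.locality f fun x hx => by
    obtain ⟨V, hV, i, h⟩ := h ⟨x, hx⟩
    exact ⟨V, hV, i.le, h⟩

theorem isSheaf : P.presheaf.IsSheaf := by
  have : Limits.PreservesLimitsOfSize.{u, u} (forget AddCommGrpCat.{max u w}) :=
    Limits.preservesLimitsOfSize_shrink.{u, max u w, u, max u w} _
  have : Limits.HasLimitsOfSize.{u, u} AddCommGrpCat.{max u w} :=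
    Limits.hasLimitsOfSizeShrink.{u, u, max u w, max u w} _
  refine (TopCat.Presheaf.isSheaf_iff_isSheaf_comp'.{u} (forget AddCommGrpCat.{max u w})
    P.presheaf).2 ?_
  exact TopCat.subpresheafToTypes.isSheaf P.toLocalPredicate

/-- The sheaf of sections satisfying the condition. -/
def sheaf : TopCat.Sheaf AddCommGrpCat.{max u w} (TopCat.of X) := ⟨P.presheaf, P.isSheaf⟩

end LocalCondition

/-! ### Minkowski space, the hyperbolic plane and its isometries -/

/-- The model space of surfaces. -/
abbrev Plane := EuclideanSpace ℝ (Fin 2)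

/-- The vector space underlying the Minkowski space `ℝ^{2,1}`. -/
abbrev R21 := Fin 3 → ℝ

/-- The Minkowski product. -/
def mink (v w : R21) : ℝ := v 0 * w 0 + v 1 * w 1 - v 2 * w 2

/-- The hyperbolic plane in the hyperboloid model. -/
def HypPlane : Type := {v : R21 // mink v v = -1 ∧ 0 < v 2}

instance : TopologicalSpace HypPlane := inferInstanceAs (TopologicalSpace (Subtype _))

/-- The inclusion of the hyperbolic plane in Minkowski space. -/
def HypPlane.incl (x : HypPlane) : R21 := x.1

/-- The point of the hyperboloid above a point of the plane, as a vector of Minkowski space. -/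
def graphMap (y : Plane) : R21 := ![y 0, y 1, √(1 + y 0 ^ 2 + y 1 ^ 2)]

/-- The projection `(v₁, v₂, v₃) ↦ (v₁, v₂)` is a homeomorphism of the hyperboloid onto the plane:
it is the global chart which defines the smooth structure of the hyperbolic plane. -/
def HypPlane.projHomeo : HypPlane ≃ₜ Plane where
  toFun x := !₂[x.1 0, x.1 1]
  invFun y := ⟨graphMap y, by
    have h : 0 < 1 + y 0 ^ 2 + y 1 ^ 2 := by positivity
    refine ⟨?_, ?_⟩
    · simp only [mink, graphMap, Matrix.cons_val]
      rw [Real.mul_self_sqrt h.le]; ring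
    · simpa [graphMap] using h⟩
  left_inv x := by
    obtain ⟨v, h1, h2⟩ := x
    apply Subtype.ext
    funext i
    fin_cases i
    · simp [graphMap]
    · simp [graphMap]
    · have : 1 + v 0 ^ 2 + v 1 ^ 2 = v 2 ^ 2 := by
        simp only [mink] at h1; linarith
      simp [graphMap, this, Real.sqrt_sq h2.le]
  right_inv y := by
    ext i; fin_cases i <;> simp [graphMap]
  continuous_toFun := by
    have : Continuous fun x : HypPlane => x.1 := continuous_subtype_val
    refine (PiLp.continuous_toLp 2 _).comp (continuous_pi fun i => ?_)
    fin_cases i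
    · change Continuous fun x : HypPlane => x.1 0
      exact (continuous_apply 0).comp this
    · change Continuous fun x : HypPlane => x.1 1
      exact (continuous_apply 1).comp this
  continuous_invFun := by
    refine Continuous.subtype_mk (continuous_pi fun i => ?_) _
    fin_cases i
    · change Continuous fun y : Plane => y 0; fun_prop
    · change Continuous fun y : Plane => y 1; fun_prop
    · change Continuous fun y : Plane => √(1 + y 0 ^ 2 + y 1 ^ 2); fun_prop

instance : ChartedSpace Plane HypPlane :=
  HypPlane.projHomeo.toOpenPartialHomeomorph.singletonChartedSpace rfl

instance : IsManifold (𝓡 2) ∞ HypPlane where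
  toHasGroupoid :=
    HypPlane.projHomeo.toOpenPartialHomeomorph.singleton_hasGroupoid rfl _

/-- The group `SO₀(2,1)` of orientation preserving, time-orientation preserving linear isometries
of Minkowski space. -/
def SO21 : Subgroup (R21 ≃ₗ[ℝ] R21) where
  carrier := {A | (∀ v w, mink (A v) (A w) = mink v w) ∧ LinearEquiv.det A = 1 ∧
    ∀ v, mink v v = -1 → (0 < (A v) 2 ↔ 0 < v 2)}
  mul_mem' := by
    rintro A B ⟨hA, hA', hA''⟩ ⟨hB, hB', hB''⟩
    refine ⟨fun v w => ?_, by rw [map_mul, hA', hB', one_mul], fun v hv => ?_⟩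
    · rw [LinearEquiv.mul_apply, LinearEquiv.mul_apply, hA, hB]
    · rw [LinearEquiv.mul_apply, hA'' _ (by rw [hB, hv]), hB'' _ hv]
  one_mem' := ⟨fun _ _ => rfl, map_one _, fun _ _ => Iff.rfl⟩
  inv_mem' := by
    rintro A ⟨hA, hA', hA''⟩
    have key : ∀ v, A (A⁻¹ v) = v := fun v => A.apply_symm_apply v
    refine ⟨fun v w => ?_, by rw [map_inv, hA', inv_one], fun v hv => ?_⟩
    · rw [← hA, key, key]
    · rw [← hA'' (A⁻¹ v) (by rw [← hA, key, hv]), key]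

/-- The action of `SO₀(2,1)` on the hyperbolic plane. -/
def SO21.act (A : SO21) (x : HypPlane) : HypPlane :=
  ⟨A.1 x.1, by rw [A.2.1]; exact x.2.1, (A.2.2.2 x.1 x.2.1).2 x.2.2⟩

/-! ### Riemannian surfaces in local coordinates -/

/-- Smooth Riemannian metrics on a surface `S`. -/
abbrev Metric (S : Type u) [TopologicalSpace S] [ChartedSpace Plane S] [IsManifold (𝓡 2) ∞ S] :=
  Bundle.ContMDiffRiemannianMetric (𝓡 2) ∞ Plane (fun x : S => TangentSpace (𝓡 2) x)

section Hyperboloid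

theorem contDiff_graphMap : ContDiff ℝ ∞ graphMap := by
  refine contDiff_pi.2 fun i => ?_
  have h (i : Fin 2) : ContDiff ℝ ∞ fun y : Plane => y i := by fun_prop
  fin_cases i
  · exact h 0
  · exact h 1
  · change ContDiff ℝ ∞ fun y : Plane => √(1 + y 0 ^ 2 + y 1 ^ 2)
    refine ContDiff.sqrt (by fun_prop) fun y => ?_
    positivity

theorem fderiv_graphMap (y v : Plane) : fderiv ℝ graphMap y v =
    ![v 0, v 1, (y 0 * v 0 + y 1 * v 1) / √(1 + y 0 ^ 2 + y 1 ^ 2)] := by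
  have hd : DifferentiableAt ℝ graphMap y :=
    contDiff_graphMap.differentiable (by simp) y
  have hp (i : Fin 3) : fderiv ℝ graphMap y v i = fderiv ℝ (fun z => graphMap z i) y v := by
    rw [fderiv_pi (fun i => differentiableAt_pi.1 hd i)]; rfl
  have hc (i : Fin 2) : HasFDerivAt (fun z : Plane => z i)
      (EuclideanSpace.proj i : Plane →L[ℝ] ℝ) y :=
    (EuclideanSpace.proj i : Plane →L[ℝ] ℝ).hasFDerivAt
  have hpos : 1 + y 0 ^ 2 + y 1 ^ 2 ≠ 0 := by positivity
  funext i
  rw [hp]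
  fin_cases i
  · exact congrArg (· v) (hc 0).fderiv
  · exact congrArg (· v) (hc 1).fderiv
  · change fderiv ℝ (fun z : Plane => √(1 + z 0 ^ 2 + z 1 ^ 2)) y v = _
    have := ((((hc 0).pow 2).const_add 1).add ((hc 1).pow 2)).sqrt hpos
    have h2 := congrArg (· v) this.fderiv
    refine Eq.trans h2 ?_
    simp
    ring

theorem HypPlane.chartAt_eq (x : HypPlane) :
    chartAt Plane x = projHomeo.toOpenPartialHomeomorph := rfl

theorem HypPlane.incl_eq : incl = graphMap ∘ projHomeo := by
  funext x
  exact congrArg Subtype.val (projHomeo.symm_apply_apply x).symm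

theorem HypPlane.contMDiff_projHomeo : ContMDiff (𝓡 2) (𝓡 2) ∞ projHomeo := by
  have := contMDiffOn_chart (I := 𝓡 2) (n := ∞) (x := projHomeo.symm 0)
  exact contMDiffOn_univ.1 this

theorem HypPlane.contMDiff_incl : ContMDiff (𝓡 2) 𝓘(ℝ, R21) ∞ incl := by
  rw [incl_eq]
  exact contDiff_graphMap.contMDiff.comp contMDiff_projHomeo

theorem HypPlane.mfderiv_incl (x : HypPlane) (v : TangentSpace (𝓡 2) x) :
    mfderiv (𝓡 2) 𝓘(ℝ, R21) incl x v = fderiv ℝ graphMap (projHomeo x) v := by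
  have h : MDifferentiableAt (𝓡 2) 𝓘(ℝ, R21) incl x :=
    contMDiff_incl.mdifferentiableAt (by simp)
  rw [h.mfderiv]
  change fderivWithin ℝ graphMap (Set.range id) (projHomeo x) v = _
  rw [Set.range_id, fderivWithin_univ]

/-- The bilinear form `(v, w) ↦ ⟨A v, A w⟩` induced on a vector space by a linear map `A` to
Minkowski space. -/
def pullMink {V : Type*} [AddCommGroup V] [Module ℝ V] [TopologicalSpace V]
    [IsTopologicalAddGroup V] [ContinuousSMul ℝ V] (A : V →L[ℝ] R21) : V →L[ℝ] V →L[ℝ] ℝ :=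
  let l (i : Fin 3) : V →L[ℝ] ℝ := (ContinuousLinearMap.proj i).comp A
  (l 0).smulRight (l 0) + (l 1).smulRight (l 1) - (l 2).smulRight (l 2)

theorem pullMink_apply {V : Type*} [AddCommGroup V] [Module ℝ V] [TopologicalSpace V]
    [IsTopologicalAddGroup V] [ContinuousSMul ℝ V] (A : V →L[ℝ] R21) (v w : V) :
    pullMink A v w = mink (A v) (A w) := by
  simp [pullMink, mink]

theorem sq_add_sq_le_pullMink (y v : Plane) : (v 0 ^ 2 + v 1 ^ 2) ≤ (1 + y 0 ^ 2 + y 1 ^ 2) *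
    mink (fderiv ℝ graphMap y v) (fderiv ℝ graphMap y v) := by
  have hpos : 0 < 1 + y 0 ^ 2 + y 1 ^ 2 := by positivity
  simp only [fderiv_graphMap, mink, Matrix.cons_val]
  rw [div_mul_div_comm, Real.mul_self_sqrt hpos.le]
  field_simp
  nlinarith [sq_nonneg (y 0 * v 1 - y 1 * v 0)]

theorem sq_add_sq_pos (v : Plane) (hv : v ≠ 0) : 0 < v 0 ^ 2 + v 1 ^ 2 := by
  have := sq_pos_of_pos (norm_pos_iff.2 hv)
  rwa [EuclideanSpace.norm_sq_eq, Fin.sum_univ_two, Real.norm_eq_abs, Real.norm_eq_abs,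
    sq_abs, sq_abs] at this

theorem contMDiff_form : ContDiff ℝ ∞ fun y : Plane => pullMink (fderiv ℝ graphMap y) := by
  have hd : ContDiff ℝ ∞ fun y : Plane => fderiv ℝ graphMap y :=
    contDiff_graphMap.fderiv_right (by simp)
  have hl (i : Fin 3) : ContDiff ℝ ∞ fun y : Plane =>
      (ContinuousLinearMap.proj (R := ℝ) (φ := fun _ : Fin 3 => ℝ) i).comp (fderiv ℝ graphMap y) :=
    contDiff_const.clm_comp hd
  exact (((hl 0).smulRight (hl 0)).add ((hl 1).smulRight (hl 1))).sub ((hl 2).smulRight (hl 2))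

/-- The hyperbolic metric: the restriction of the Minkowski product to the tangent spaces of the
hyperboloid. -/
def hypMetric : Metric HypPlane where
  inner x := pullMink (mfderiv (𝓡 2) 𝓘(ℝ, R21) HypPlane.incl x)
  symm x v w := by
    erw [pullMink_apply, pullMink_apply]
    simp only [mink]; ring
  pos x v hv := by
    erw [pullMink_apply, HypPlane.mfderiv_incl]
    have h := sq_add_sq_le_pullMink (HypPlane.projHomeo x) v
    have h2 := sq_add_sq_pos v hv
    have hpos : 0 < 1 + HypPlane.projHomeo x 0 ^ 2 + HypPlane.projHomeo x 1 ^ 2 := by positivity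
    exact pos_of_mul_pos_right (h2.trans_le h) hpos.le
  isVonNBounded x := by
    have key : Bornology.IsVonNBounded ℝ {v : Plane | mink (fderiv ℝ graphMap
        (HypPlane.projHomeo x) v) (fderiv ℝ graphMap (HypPlane.projHomeo x) v) < 1} := by
      rw [NormedSpace.isVonNBounded_iff]
      refine (Metric.isBounded_closedBall (x := (0 : Plane))
        (r := √(1 + HypPlane.projHomeo x 0 ^ 2 + HypPlane.projHomeo x 1 ^ 2))).subset
        fun v hv => ?_
      have h := sq_add_sq_le_pullMink (HypPlane.projHomeo x) v
      have hpos : 0 < 1 + HypPlane.projHomeo x 0 ^ 2 + HypPlane.projHomeo x 1 ^ 2 := by positivity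
      rw [mem_closedBall_zero_iff, EuclideanSpace.norm_eq]
      refine Real.sqrt_le_sqrt ?_
      rw [Fin.sum_univ_two, Real.norm_eq_abs, Real.norm_eq_abs, sq_abs, sq_abs]
      refine h.trans ?_
      simpa using mul_le_mul_of_nonneg_left (le_of_lt hv) hpos.le
    have h2 : {v : TangentSpace (𝓡 2) x | pullMink (mfderiv (𝓡 2) 𝓘(ℝ, R21) HypPlane.incl x) v v
        < 1} = {v : Plane | mink (fderiv ℝ graphMap (HypPlane.projHomeo x) v)
          (fderiv ℝ graphMap (HypPlane.projHomeo x) v) < 1} := by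
      ext v
      simp only [Set.mem_ofPred_eq]
      erw [pullMink_apply, HypPlane.mfderiv_incl]
      rfl
    exact h2 ▸ key
  contMDiff := by
    intro x
    rw [contMDiffAt_hom_bundle]
    refine ⟨contMDiff_id x, ?_⟩
    have := (contMDiff_form.contMDiff.comp HypPlane.contMDiff_projHomeo) x
    refine this.congr_of_eventuallyEq (Filter.Eventually.of_forall fun z => ?_)
    have hz : z ∈ (chartAt Plane x).source := Set.mem_univ z
    have hs (v : Plane) : (trivializationAt Plane (TangentSpace (𝓡 2)) x).symm z v = v := by
      have h1 := TangentBundle.symmL_trivializationAt_eq_core (I := 𝓡 2) hz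
      have h2 := congrArg (fun A => A v) h1
      refine Eq.trans ?_ (h2.trans ?_)
      · exact (Bundle.Trivialization.symmL_apply _ (by exact hz) _).symm
      · exact (tangentBundleCore (𝓡 2) HypPlane).coordChange_self (achart Plane z) z hz v
    ext v w
    rw [inCoordinates_apply_eq₂ (by simp) (by simp) (by simp)]
    erw [hs, hs, pullMink_apply, HypPlane.mfderiv_incl, HypPlane.mfderiv_incl]
    simp [pullMink_apply]

end Hyperboloid
section Coordinates

variable {S : Type u} [TopologicalSpace S] [ChartedSpace Plane S]

/-- The `i`-th partial derivative of a function on the plane. -/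
def pd (i : Fin 2) (f : Plane → ℝ) (y : Plane) : ℝ := fderiv ℝ f y (EuclideanSpace.single i 1)

/-- The coordinate covector `dxᵢ` of the chart `e`. -/
def dx (e : OpenPartialHomeomorph S Plane) (i : Fin 2) (x : S) : TangentSpace (𝓡 2) x →L[ℝ] ℝ :=
  ContinuousLinearMap.comp (EuclideanSpace.proj i : Plane →L[ℝ] ℝ) (mfderiv (𝓡 2) (𝓡 2) e x)

/-- The coordinate vector `∂ᵢ` of the chart `e`. -/
def coordVec (e : OpenPartialHomeomorph S Plane) (i : Fin 2) (x : S) : TangentSpace (𝓡 2) x :=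
  (mfderiv (𝓡 2) (𝓡 2) e x).inverse (EuclideanSpace.single i (1 : ℝ) : Plane)

/-- The matrix in the chart `e` of a field `b` of endomorphisms of the tangent spaces: the
coefficient `b^k_j`, as a function of the coordinates. -/
def opCoord (e : OpenPartialHomeomorph S Plane)
    (b : ∀ x : S, TangentSpace (𝓡 2) x →L[ℝ] TangentSpace (𝓡 2) x)
    (k j : Fin 2) (y : Plane) : ℝ :=
  dx e k (e.symm y) (b (e.symm y) (coordVec e j (e.symm y)))

section opCoord

variable {V : Set S} {b c : ∀ x : S, TangentSpace (𝓡 2) x →L[ℝ] TangentSpace (𝓡 2) x}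
  {e : OpenPartialHomeomorph S Plane}

theorem opCoord_eventuallyEq (hV : IsOpen V) (hbc : ∀ x ∈ V, b x = c x) {y : Plane}
    (hy : y ∈ e.target) (hyV : e.symm y ∈ V) (k j : Fin 2) :
    opCoord e b k j =ᶠ[𝓝 y] opCoord e c k j := by
  filter_upwards [(e.continuousAt_symm hy).preimage_mem_nhds (hV.mem_nhds hyV)] with z hz
  rw [opCoord, opCoord, hbc _ hz]

theorem opCoord_zero (k j : Fin 2) : opCoord e (fun _ : S => 0) k j = fun _ => 0 := by
  funext y; simp [opCoord]

theorem opCoord_add (k j : Fin 2) :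
    opCoord e (fun x => b x + c x) k j = fun y => opCoord e b k j y + opCoord e c k j y := by
  funext y; simp [opCoord]

theorem opCoord_neg (k j : Fin 2) :
    opCoord e (fun x => - b x) k j = fun y => - opCoord e b k j y := by
  funext y; simp [opCoord]

end opCoord

variable [IsManifold (𝓡 2) ∞ S] (h : Metric S) (e : OpenPartialHomeomorph S Plane)

/-- The matrix `g_{ij}` of the metric in the chart `e`. -/
def gram (y : Plane) : Matrix (Fin 2) (Fin 2) ℝ :=
  .of fun i j => h.inner (e.symm y) (coordVec e i (e.symm y)) (coordVec e j (e.symm y))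

/-- The Christoffel symbols `Γ^k_{ij}` of the Levi-Civita connection in the chart `e`. -/
def christoffel (i j k : Fin 2) (y : Plane) : ℝ :=
  (1 / 2) * ∑ l, (gram h e y)⁻¹ k l * (pd i (fun z => gram h e z j l) y +
    pd j (fun z => gram h e z i l) y - pd l (fun z => gram h e z i j) y)

/-- The `k`-th component of the Levi-Civita covariant derivative `∇_{∂ᵢ} X` of a vector field with
components `X`. -/
def covDeriv (i : Fin 2) (X : Fin 2 → Plane → ℝ) (k : Fin 2) (y : Plane) : ℝ :=
  pd i (X k) y + ∑ l, christoffel h e i l k y * X l y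

/-- The `k`-th component of the gradient of `u`. -/
def gradCoord (u : S → ℝ) (k : Fin 2) (y : Plane) : ℝ :=
  ∑ l, (gram h e y)⁻¹ k l * pd l (u ∘ e.symm) y

/-- The operator `Hess u = ∇ grad u` on the tangent space at `x`. -/
def hess (u : S → ℝ) (x : S) : TangentSpace (𝓡 2) x →L[ℝ] TangentSpace (𝓡 2) x :=
  let e := chartAt Plane x
  ∑ k, ∑ j, covDeriv h e j (gradCoord h e u) k (e x) • (dx e j x).smulRight (coordVec e k x)

/-- The operator `H u = Hess u - u I` on the tangent space at `x`. -/
def hessOp (u : S → ℝ) (x : S) : TangentSpace (𝓡 2) x →L[ℝ] TangentSpace (𝓡 2) x :=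
  hess h u x - u x • ContinuousLinearMap.id ℝ (TangentSpace (𝓡 2) x)

/-- The field `b` of endomorphisms of the tangent spaces is, over the open set `U`, smooth,
self-adjoint for `h`, and satisfies the Codazzi equation
`∇_{∂ᵢ} (b ∂ⱼ) - ∇_{∂ⱼ} (b ∂ᵢ) - b [∂ᵢ, ∂ⱼ] = 0` in all charts of `S` (here `[∂ᵢ, ∂ⱼ] = 0`). -/
structure IsCodazziOn (U : Set S)
    (b : ∀ x : S, TangentSpace (𝓡 2) x →L[ℝ] TangentSpace (𝓡 2) x) : Prop where
  smooth : ∀ e ∈ atlas Plane S, ∀ k j,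
    ContDiffOn ℝ ∞ (opCoord e b k j) (e.target ∩ e.symm ⁻¹' U)
  selfAdjoint : ∀ x ∈ U, ∀ v w, h.inner x (b x v) w = h.inner x v (b x w)
  codazzi : ∀ e ∈ atlas Plane S, ∀ y ∈ e.target, e.symm y ∈ U → ∀ i j k,
    covDeriv h e i (fun l => opCoord e b l j) k y = covDeriv h e j (fun l => opCoord e b l i) k y

/-! ### The sheaves of smooth functions and of Codazzi operators -/

open Classical in
/-- Extension by zero of a section over `U`. It is only used on `U`. -/
def extend {X : Type u} [TopologicalSpace X] {T : X → Type w} [∀ x, AddCommGroup (T x)]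
    (U : Opens X) (f : ∀ x : U, T x) (x : X) : T x :=
  if hx : x ∈ U then f ⟨x, hx⟩ else 0

section extend

variable {X : Type u} [TopologicalSpace X] {T : X → Type w} [∀ x, AddCommGroup (T x)]

theorem extend_of_mem {U : Opens X} (f : ∀ x : U, T x) {x : X} (hx : x ∈ U) :
    extend U f x = f ⟨x, hx⟩ := dif_pos hx

theorem extend_restrict {U V : Opens X} (i : U ≤ V) (f : ∀ x : V, T x) {x : X} (hx : x ∈ U) :
    extend U (fun x => f ⟨x, i x.2⟩) x = extend V f x := by
  rw [extend_of_mem _ hx, extend_of_mem _ (i hx)]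

theorem extend_zero (U : Opens X) : extend U (fun x => (0 : T x)) = fun _ => 0 := by
  funext x; by_cases hx : x ∈ U <;> simp [extend, hx]

theorem extend_add (U : Opens X) (f g : ∀ x : U, T x) :
    extend U (fun x => f x + g x) = fun x => extend U f x + extend U g x := by
  funext x; by_cases hx : x ∈ U <;> simp [extend, hx]

theorem extend_neg (U : Opens X) (f : ∀ x : U, T x) :
    extend U (fun x => - f x) = fun x => - extend U f x := by
  funext x; by_cases hx : x ∈ U <;> simp [extend, hx]

end extend

variable (S) in
/-- Smoothness of functions. -/
def smoothCondition : LocalCondition (fun _ : S => ℝ) where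
  pred U u := ContMDiffOn (𝓡 2) 𝓘(ℝ, ℝ) ∞ (extend U u) U
  res i f hf := (hf.mono i).congr fun x hx => extend_restrict (T := fun _ : S => ℝ) i f hx
  locality {U} f hf x hx := by
    obtain ⟨V, hV, i, hf⟩ := hf x hx
    have h1 := (hf x hV).contMDiffAt (V.isOpen.mem_nhds hV)
    refine (h1.congr_of_eventuallyEq ?_).contMDiffWithinAt
    filter_upwards [V.isOpen.mem_nhds hV] with z hz
    exact (extend_restrict (T := fun _ : S => ℝ) i f hz).symm
  zero U := by rw [extend_zero]; exact contMDiffOn_const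
  add hf hg := by rw [extend_add]; exact hf.add hg
  neg hf := by rw [extend_neg]; exact hf.neg

section codazzi

variable {h e} {U V : Set S} {b c : ∀ x : S, TangentSpace (𝓡 2) x →L[ℝ] TangentSpace (𝓡 2) x}

theorem pd_congr {i : Fin 2} {f g : Plane → ℝ} {y : Plane} (hfg : f =ᶠ[𝓝 y] g) :
    pd i f y = pd i g y := by
  rw [pd, pd, hfg.fderiv_eq]

theorem covDeriv_congr {i k : Fin 2} {X Y : Fin 2 → Plane → ℝ} {y : Plane}
    (hXY : ∀ l, X l =ᶠ[𝓝 y] Y l) : covDeriv h e i X k y = covDeriv h e i Y k y := by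
  rw [covDeriv, covDeriv, pd_congr (hXY k)]
  simp only [fun l => (hXY l).eq_of_nhds]

theorem covDeriv_zero {i k : Fin 2} {y : Plane} : covDeriv h e i (fun _ _ => 0) k y = 0 := by
  simp [covDeriv, pd]

theorem covDeriv_add {i k : Fin 2} {X Y : Fin 2 → Plane → ℝ} {y : Plane}
    (hX : ∀ l, DifferentiableAt ℝ (X l) y) (hY : ∀ l, DifferentiableAt ℝ (Y l) y) :
    covDeriv h e i (fun l z => X l z + Y l z) k y = covDeriv h e i X k y + covDeriv h e i Y k y := by
  simp only [covDeriv, pd]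
  rw [fderiv_fun_add (hX k) (hY k)]
  simp [mul_add]
  ring

theorem covDeriv_neg {i k : Fin 2} {X : Fin 2 → Plane → ℝ} {y : Plane} :
    covDeriv h e i (fun l z => - X l z) k y = - covDeriv h e i X k y := by
  simp only [covDeriv, pd]
  rw [fderiv_fun_neg]
  simp
  ring

theorem IsCodazziOn.of_locally
    (hloc : ∀ x ∈ U, ∃ (V : Set S) (c : ∀ x : S, TangentSpace (𝓡 2) x →L[ℝ] TangentSpace (𝓡 2) x),
      IsOpen V ∧ x ∈ V ∧ (∀ z ∈ V, b z = c z) ∧ IsCodazziOn h V c) : IsCodazziOn h U b where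
  smooth e he k j y hy := by
    obtain ⟨V, c, hV, hyV, hbc, hc⟩ := hloc _ hy.2
    have h1 : ContDiffAt ℝ ∞ (opCoord e c k j) y := (hc.smooth e he k j).contDiffAt
      ((e.isOpen_inter_preimage_symm hV).mem_nhds ⟨hy.1, hyV⟩)
    exact (h1.congr_of_eventuallyEq
      (opCoord_eventuallyEq hV hbc hy.1 hyV k j)).contDiffWithinAt
  selfAdjoint x hx v w := by
    obtain ⟨V, c, hV, hxV, hbc, hc⟩ := hloc x hx
    rw [hbc x hxV]
    exact hc.selfAdjoint x hxV v w
  codazzi e he y hy hyU i j k := by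
    obtain ⟨V, c, hV, hyV, hbc, hc⟩ := hloc _ hyU
    rw [covDeriv_congr fun l => opCoord_eventuallyEq hV hbc hy hyV l j,
      covDeriv_congr fun l => opCoord_eventuallyEq hV hbc hy hyV l i]
    exact hc.codazzi e he y hy hyV i j k

theorem IsCodazziOn.differentiableAt (hU : IsOpen U) (hb : IsCodazziOn h U b)
    (he : e ∈ atlas Plane S) {y : Plane} (hy : y ∈ e.target) (hyU : e.symm y ∈ U) (k j : Fin 2) :
    DifferentiableAt ℝ (opCoord e b k j) y :=
  ((hb.smooth e he k j).contDiffAt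
    ((e.isOpen_inter_preimage_symm hU).mem_nhds ⟨hy, hyU⟩)).differentiableAt (by simp)

theorem IsCodazziOn.zero : IsCodazziOn h U (fun _ => 0) where
  smooth e he k j := by rw [opCoord_zero]; exact contDiffOn_const
  selfAdjoint x hx v w := by simp
  codazzi e he y hy hyU i j k := by simp only [opCoord_zero, covDeriv_zero]

theorem IsCodazziOn.add (hU : IsOpen U) (hb : IsCodazziOn h U b) (hc : IsCodazziOn h U c) :
    IsCodazziOn h U (fun x => b x + c x) where
  smooth e he k j := by rw [opCoord_add]; exact (hb.smooth e he k j).add (hc.smooth e he k j)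
  selfAdjoint x hx v w := by
    simp [hb.selfAdjoint x hx, hc.selfAdjoint x hx]
  codazzi e he y hy hyU i j k := by
    simp only [opCoord_add]
    rw [covDeriv_add (fun l => hb.differentiableAt hU he hy hyU l j)
      (fun l => hc.differentiableAt hU he hy hyU l j),
      covDeriv_add (fun l => hb.differentiableAt hU he hy hyU l i)
      (fun l => hc.differentiableAt hU he hy hyU l i),
      hb.codazzi e he y hy hyU, hc.codazzi e he y hy hyU]

theorem IsCodazziOn.neg (hb : IsCodazziOn h U b) : IsCodazziOn h U (fun x => - b x) where
  smooth e he k j := by rw [opCoord_neg]; exact (hb.smooth e he k j).neg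
  selfAdjoint x hx v w := by simp [hb.selfAdjoint x hx]
  codazzi e he y hy hyU i j k := by
    simp only [opCoord_neg]
    rw [covDeriv_neg, covDeriv_neg, hb.codazzi e he y hy hyU]

end codazzi

/-- The condition of being a smooth self-adjoint Codazzi operator. -/
def codazziCondition :
    LocalCondition (fun x : S => TangentSpace (𝓡 2) x →L[ℝ] TangentSpace (𝓡 2) x) where
  pred U b := IsCodazziOn h U (extend U b)
  res {U V} i f hf := .of_locally fun x hx =>
    ⟨U, _, U.isOpen, hx, fun z hz => extend_restrict
      (T := fun x : S => TangentSpace (𝓡 2) x →L[ℝ] TangentSpace (𝓡 2) x) i f hz, by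
      exact .of_locally fun z hz => ⟨V, _, V.isOpen, i hz, fun _ _ => rfl, hf⟩⟩
  locality {U} f hf := .of_locally fun x hx => by
    obtain ⟨V, hV, i, hf⟩ := hf x hx
    exact ⟨V, _, V.isOpen, hV, fun z hz => (extend_restrict
      (T := fun x : S => TangentSpace (𝓡 2) x →L[ℝ] TangentSpace (𝓡 2) x) i f hz).symm, hf⟩
  zero U := by rw [extend_zero]; exact .zero
  add {U} _ _ hf hg := by rw [extend_add]; exact hf.add U.isOpen hg
  neg hf := by rw [extend_neg]; exact hf.neg

variable (S) in
/-- The sheaf of smooth functions. -/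
def smoothFunctions : TopCat.Sheaf AddCommGrpCat.{u} (TopCat.of S) := (smoothCondition S).sheaf

/-- The sheaf of self-adjoint Codazzi operators. -/
def codazziOperators : TopCat.Sheaf AddCommGrpCat.{u} (TopCat.of S) := (codazziCondition h).sheaf

end Coordinates
/-! ### The developing map, the holonomy and the flat bundle -/

section Flat

variable {S St : Type u} [TopologicalSpace S] [TopologicalSpace St]

/-- The group of deck transformations of `p`. For a universal covering `p` of `S` this is the
fundamental group of `S`. -/
def Deck (p : St → S) : Subgroup (St ≃ₜ St) where
  carrier := {α | ∀ x, p (α x) = p x}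
  mul_mem' {α β} hα hβ x := (hα (β x)).trans (hβ x)
  one_mem' _ := rfl
  inv_mem' {α} hα x := by
    have := hα (α⁻¹ x)
    rw [← this]
    exact congrArg p (α.apply_symm_apply x)

variable [ChartedSpace Plane S] [ChartedSpace Plane St]

/-- `p` is the universal covering of the surface `S`; the smooth structure of the total space is
lifted from `S`. -/
structure IsUniversalCovering (p : St → S) : Prop where
  simplyConnected : SimplyConnectedSpace St
  surjective : Function.Surjective p
  isCoveringMap : IsCoveringMap p
  isLocalDiffeomorph : IsLocalDiffeomorph (𝓡 2) (𝓡 2) ∞ p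

namespace IsUniversalCovering

variable {p : St → S}

theorem existsUnique_lift (hp : IsUniversalCovering p) {a b : St} (hab : p a = p b) :
    ∃! F : C(St, St), F a = b ∧ p ∘ F = p := by
  have := hp.simplyConnected
  have : LocallyPathConnectedSpace St := ChartedSpace.locallyPathConnectedSpace Plane St
  exact hp.isCoveringMap.existsUnique_continuousMap_lifts ⟨p, hp.isCoveringMap.continuous⟩
    (a₀ := a) (e₀ := b) hab.symm

/-- The fundamental group acts transitively on the fibres of the universal covering. -/
theorem exists_deck (hp : IsUniversalCovering p) {a b : St} (hab : p a = p b) : ∃ α : Deck p, α.1 a = b := by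
  obtain ⟨F, ⟨hF, hpF⟩, -⟩ := hp.existsUnique_lift hab
  obtain ⟨G, ⟨hG, hpG⟩, -⟩ := hp.existsUnique_lift hab.symm
  have h1 : G.comp F = ContinuousMap.id St := (hp.existsUnique_lift (rfl : p a = p a)).unique
    ⟨by simp [hF, hG], by funext x; simpa using (congrFun hpG (F x)).trans (congrFun hpF x)⟩
    ⟨rfl, rfl⟩
  have h2 : F.comp G = ContinuousMap.id St := (hp.existsUnique_lift (rfl : p b = p b)).unique
    ⟨by simp [hF, hG], by funext x; simpa using (congrFun hpF (G x)).trans (congrFun hpG x)⟩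
    ⟨rfl, rfl⟩
  exact ⟨⟨⟨⟨F, G, fun x => DFunLike.congr_fun h1 x, fun x => DFunLike.congr_fun h2 x⟩,
    F.continuous, G.continuous⟩, fun x => congrFun hpF x⟩, hF⟩

/-- The fundamental group acts freely on the universal covering. -/
theorem deck_eq_one (hp : IsUniversalCovering p) {α : Deck p} {a : St} (ha : α.1 a = a) : α = 1 := by
  have h := (hp.existsUnique_lift (rfl : p a = p a)).unique
    (y₁ := ⟨α.1, α.1.continuous⟩) (y₂ := ContinuousMap.id St)
    ⟨ha, funext fun x => α.2 x⟩ ⟨rfl, rfl⟩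
  exact Subtype.ext (Homeomorph.ext fun x => DFunLike.congr_fun h x)

end IsUniversalCovering

variable [IsManifold (𝓡 2) ∞ S]

/-- A hyperbolic structure on the surface `S` with metric `h`, given on the universal covering
`p : St → S` by a developing map `dev : St → ℍ²`, which is a local isometry for the metric lifted
from `h`, and a holonomy representation `hol : π₁(S) → SO₀(2,1)` for which `dev` is equivariant.
By the classical theory of
geometric structures it exists exactly for the metrics of constant curvature `-1`, complete or not,
on connected orientable surfaces. -/
structure HyperbolicStructure (h : Metric S) (p : St → S) where
  isUniversalCovering : IsUniversalCovering p
  dev : St → HypPlane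
  hol : Deck p →* SO21
  contMDiff_dev : ContMDiff (𝓡 2) (𝓡 2) ∞ dev
  isometry : ∀ (x : St) (v w : TangentSpace (𝓡 2) x),
    hypMetric.inner (dev x) (mfderiv (𝓡 2) (𝓡 2) dev x v) (mfderiv (𝓡 2) (𝓡 2) dev x w) =
      h.inner (p x) (mfderiv (𝓡 2) (𝓡 2) p x v) (mfderiv (𝓡 2) (𝓡 2) p x w)
  equivariant : ∀ (α : Deck p) (x : St), dev (α.1 x) = SO21.act (hol α) (dev x)

namespace HyperbolicStructure

variable {h : Metric S} {p : St → S} (D : HyperbolicStructure h p)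

/-- The product action of the fundamental group on `St × ℝ^{2,1}`, by deck transformations on the
first component and through the holonomy on the second one: the orbit relation. -/
def orbitSetoid : Setoid (St × R21) where
  r a b := ∃ α : Deck p, (α.1 a.1, (D.hol α).1 a.2) = b
  iseqv := by
    refine ⟨fun a => ⟨1, by simp⟩, ?_, ?_⟩
    · rintro a b ⟨α, rfl⟩
      refine ⟨α⁻¹, ?_⟩
      rw [map_inv]
      exact Prod.ext (α.1.symm_apply_apply a.1) ((D.hol α).1.symm_apply_apply a.2)
    · rintro a b c ⟨α, rfl⟩ ⟨β, rfl⟩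
      exact ⟨β * α, by rw [map_mul]; rfl⟩

/-- The flat bundle `F → S` with fibre `ℝ^{2,1}` and holonomy `hol`: the quotient of
`St × ℝ^{2,1}` by the action of the fundamental group. -/
def FlatBundle : Type u := Quotient D.orbitSetoid

/-- The projection `F → S`. -/
def proj : D.FlatBundle → S :=
  Quotient.lift (fun a => p a.1) (by rintro a b ⟨α, rfl⟩; exact (α.2 a.1).symm)

/-- The class in `F` of a pair in `St × ℝ^{2,1}`. -/
def toBundle (a : St) (v : R21) : D.FlatBundle := Quotient.mk D.orbitSetoid (a, v)

theorem toBundle_eq_toBundle {a b : St} {v w : R21} :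
    D.toBundle a v = D.toBundle b w ↔ ∃ α : Deck p, α.1 a = b ∧ (D.hol α).1 v = w := by
  refine Quotient.eq.trans ?_
  exact exists_congr fun α => Prod.mk_inj

/-- The fibre of `F` over `x`. -/
def Fiber (x : S) : Type u := {q : D.FlatBundle // D.proj q = x}

/-- A point `a` of the universal covering over `x` identifies `ℝ^{2,1}` with the fibre of `F`
over `x`. -/
def fiberEquiv (a : St) {x : S} (ha : p a = x) : R21 ≃ D.Fiber x :=
  Equiv.ofBijective (fun v => ⟨D.toBundle a v, ha⟩) <| by
    constructor
    · intro v w hvw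
      obtain ⟨α, hα, rfl⟩ := D.toBundle_eq_toBundle.1 (congrArg Subtype.val hvw)
      rw [D.isUniversalCovering.deck_eq_one hα, map_one]
      rfl
    · rintro ⟨q, hq⟩
      induction q using Quotient.inductionOn with
      | h c =>
        obtain ⟨b, w⟩ := c
        have hb : p b = x := hq
        obtain ⟨α, hα⟩ := D.isUniversalCovering.exists_deck (hb.trans ha.symm)
        exact ⟨(D.hol α).1 w, Subtype.ext (D.toBundle_eq_toBundle.2 ⟨α, hα, rfl⟩).symm⟩

/-- A point of the universal covering over `x`. -/
def pt (x : S) : St := (D.isUniversalCovering.surjective x).choose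

theorem p_pt (x : S) : p (D.pt x) = x := (D.isUniversalCovering.surjective x).choose_spec

instance (x : S) : AddCommGroup (D.Fiber x) := (D.fiberEquiv (D.pt x) (D.p_pt x)).symm.addCommGroup

/-- Changing the point of the universal covering over `x` changes the identification of the fibre
with `ℝ^{2,1}` by an element of `SO₀(2,1)`. -/
theorem exists_fiberEquiv_eq {a b : St} {x : S} (ha : p a = x) (hb : p b = x) :
    ∃ α : Deck p, α.1 a = b ∧
      ∀ v, D.fiberEquiv a ha v = D.fiberEquiv b hb ((D.hol α).1 v) := by
  obtain ⟨α, hα⟩ := D.isUniversalCovering.exists_deck (ha.trans hb.symm)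
  exact ⟨α, hα, fun v => Subtype.ext (D.toBundle_eq_toBundle.2 ⟨α, hα, rfl⟩)⟩

/-- The group structure of the fibres does not depend on choices. -/
theorem fiberEquiv_add {a : St} {x : S} (ha : p a = x) (v w : R21) :
    D.fiberEquiv a ha (v + w) = D.fiberEquiv a ha v + D.fiberEquiv a ha w := by
  obtain ⟨α, -, hα⟩ := D.exists_fiberEquiv_eq ha (D.p_pt x)
  rw [hα, hα, hα, map_add]
  change _ = D.fiberEquiv (D.pt x) (D.p_pt x) (_ + _)
  exact congrArg _ (congrArg₂ (· + ·) (Equiv.symm_apply_apply _ _).symm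
    (Equiv.symm_apply_apply _ _).symm)

theorem fiberEquiv_zero {a : St} {x : S} (ha : p a = x) : D.fiberEquiv a ha 0 = 0 := by
  have := D.fiberEquiv_add ha 0 0
  rw [add_zero] at this
  exact left_eq_add.1 this

theorem fiberEquiv_neg {a : St} {x : S} (ha : p a = x) (v : R21) :
    D.fiberEquiv a ha (-v) = - D.fiberEquiv a ha v := by
  rw [eq_neg_iff_add_eq_zero, ← fiberEquiv_add, neg_add_cancel, fiberEquiv_zero]

/-- The Minkowski product on the fibres of `F`. -/
def fiberMink {x : S} (q r : D.Fiber x) : ℝ :=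
  mink ((D.fiberEquiv (D.pt x) (D.p_pt x)).symm q) ((D.fiberEquiv (D.pt x) (D.p_pt x)).symm r)

/-- The Minkowski product of the fibres does not depend on choices. -/
theorem fiberMink_fiberEquiv {a : St} {x : S} (ha : p a = x) (v w : R21) :
    D.fiberMink (D.fiberEquiv a ha v) (D.fiberEquiv a ha w) = mink v w := by
  obtain ⟨α, -, hα⟩ := D.exists_fiberEquiv_eq ha (D.p_pt x)
  rw [fiberMink, hα, hα, Equiv.symm_apply_apply, Equiv.symm_apply_apply, (D.hol α).2.1]

/-- The developing section `ι : S → F` induced by the developing map. -/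
def devSection (x : S) : D.Fiber x := D.fiberEquiv (D.pt x) (D.p_pt x) (D.dev (D.pt x)).incl

/-- The developing section does not depend on choices. -/
theorem devSection_eq {a : St} {x : S} (ha : p a = x) :
    D.devSection x = D.fiberEquiv a ha (D.dev a).incl := by
  obtain ⟨α, hα, h⟩ := D.exists_fiberEquiv_eq ha (D.p_pt x)
  rw [h, devSection]
  refine congrArg (D.fiberEquiv (D.pt x) (D.p_pt x)) ?_
  rw [← hα, D.equivariant]
  rfl

/-- Flatness of sections of `F`: locally, the section is the image of a constant section of
`St × ℝ^{2,1} → St`. -/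
def flatCondition : LocalCondition D.Fiber where
  pred U σ := ∀ a : St, p a ∈ U → ∃ t : R21, ∀ᶠ b in 𝓝 a, ∀ hb : p b ∈ U,
    σ ⟨p b, hb⟩ = D.fiberEquiv b rfl t
  res {U V} i σ hσ a ha := by
    obtain ⟨t, ht⟩ := hσ a (i ha)
    exact ⟨t, ht.mono fun b hb hbU => hb (i hbU)⟩
  locality {U} σ hσ a ha := by
    obtain ⟨V, hV, i, hσ⟩ := hσ _ ha
    obtain ⟨t, ht⟩ := hσ a hV
    refine ⟨t, ?_⟩
    filter_upwards [ht, (D.isUniversalCovering.isCoveringMap.continuous.continuousAt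
      (x := a)).preimage_mem_nhds (V.isOpen.mem_nhds hV)] with b hb hbV hbU
    exact hb hbV
  zero U a ha := ⟨0, .of_forall fun b hb => (D.fiberEquiv_zero rfl).symm⟩
  add {U σ τ} hσ hτ a ha := by
    obtain ⟨t, ht⟩ := hσ a ha
    obtain ⟨s, hs⟩ := hτ a ha
    refine ⟨t + s, ?_⟩
    filter_upwards [ht, hs] with b hb hb' hbU
    rw [fiberEquiv_add, hb hbU, hb' hbU]
  neg {U σ} hσ a ha := by
    obtain ⟨t, ht⟩ := hσ a ha
    refine ⟨-t, ?_⟩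
    filter_upwards [ht] with b hb hbU
    rw [fiberEquiv_neg, hb hbU]

/-- The sheaf `ℱ` of flat sections of `F`. -/
def flatSections : TopCat.Sheaf AddCommGrpCat.{u} (TopCat.of S) := D.flatCondition.sheaf

end HyperbolicStructure

end Flat

/-- Convexity of sets in the hyperbolic plane: the geodesic segment joining two points of the
hyperboloid consists of the points of the hyperboloid which are nonnegative combinations of them. -/
def GeodesicallyConvex (U : Set HypPlane) : Prop :=
  ∀ x ∈ U, ∀ y ∈ U, ∀ z : HypPlane, ∀ a b : ℝ, 0 ≤ a → 0 ≤ b →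
    z.incl = a • x.incl + b • y.incl → z ∈ U

/-- The space of smooth functions `u` on `U` with `H u = 0`. -/
def kernelH {S : Type u} [TopologicalSpace S] [ChartedSpace Plane S] [IsManifold (𝓡 2) ∞ S]
    (h : Metric S) (U : Opens S) : Set (U → ℝ) :=
  {u | u ∈ (smoothCondition S).sections U ∧
    ∀ x ∈ U, hessOp h (extend (T := fun _ => ℝ) U u) x = 0}

/-- The map sending a vector `t` to the function `x ↦ ⟨t, x⟩` on a subset of the hyperbolic
plane. -/
def minkFunction (U : Opens HypPlane) : R21 →ₗ[ℝ] (U → ℝ) where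
  toFun t x := mink t x.1.incl
  map_add' s t := by funext x; simp [mink]; ring
  map_smul' c t := by funext x; simp [mink]; ring

end HypSurf

end

open HypSurf

/-!
Let `f` be a local developing map of the surface: a local isometry to the hyperboloid, viewed as a
map to Minkowski space, obtained from `dev` and a local section of the universal covering. The
Gauss formula says that the normal component of the derivative of a vector field `df X` tangent to
the hyperboloid is `h(X, ·) f`, because the normal vector at `f` is `f` itself.

To a function `u` corresponds its support vector `T = grad u - u f`, the unique vector with
`⟨T, f⟩ = u` and `⟨T, df⟩ = du`. Two consequences of the Gauss formula carry the argument.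

* The differential of `T` is `df ∘ (Hess u - u I)` (`LocalDevelopment.mfderiv_support`).
* For a field `b` of operators, the one-form `df ∘ b` with values in Minkowski space is closed if
  and only if `b` is self-adjoint and satisfies the Codazzi equation: these are the normal and the
  tangential component of the equation `d (df ∘ b) = 0` (`LocalDevelopment.isCodazziOn_iff`).

Hence `Hess u - u I` is a self-adjoint Codazzi operator, since `dT` is closed. If it vanishes, `T` is
locally constant and `u = ⟨T, f⟩`: this is exactness in the middle
(`LocalDevelopment.exists_eventually_eq_mink`). Conversely, given `b`, the Poincaré lemma yields `T`
with `dT = df ∘ b`; then `T` is the support vector of `u = ⟨T, f⟩`, whence `Hess u - u I = b`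
(`LocalDevelopment.exists_hessOp_eq`). Since `f` and its derivatives span Minkowski space, a vector
is determined by its products with the values of `f` near a point; this gives injectivity on flat
sections.

On the hyperbolic plane the inclusion is a global developing map. There the support vector of a
function in the kernel is constant on connected sets, in particular on convex ones.

The coordinate computations are made in an arbitrary chart (`CoordDevelopment`), and the uniqueness
of the support vector makes the results independent of the chart.
-/

noncomputable section

namespace HypSurf

/-! ### Algebra of the Minkowski product -/

theorem mink_comm (v w : R21) : mink v w = mink w v := by simp only [mink]; ring

theorem mink_add_left (u v w : R21) : mink (u + v) w = mink u w + mink v w := by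
  simp only [mink, Pi.add_apply]; ring

theorem mink_sub_left (u v w : R21) : mink (u - v) w = mink u w - mink v w := by
  simp only [mink, Pi.sub_apply]; ring

theorem mink_smul_left (c : ℝ) (v w : R21) : mink (c • v) w = c * mink v w := by
  simp only [mink, Pi.smul_apply, smul_eq_mul]; ring

theorem mink_add_right (u v w : R21) : mink u (v + w) = mink u v + mink u w := by
  simp only [mink, Pi.add_apply]; ring

theorem mink_smul_right (c : ℝ) (v w : R21) : mink v (c • w) = c * mink v w := by
  simp only [mink, Pi.smul_apply, smul_eq_mul]; ring

theorem mink_zero_left (w : R21) : mink 0 w = 0 := by simp [mink]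

/-- A unit timelike vector `a` and two vectors `b₀`, `b₁` orthogonal to it with invertible Gram
matrix span Minkowski space, so that only the zero vector is orthogonal to the three of them. -/
theorem eq_zero_of_mink_eq_zero {a t : R21} {b : Fin 2 → R21} (ha : mink a a = -1)
    (hab : ∀ i, mink a (b i) = 0)
    (hb : (Matrix.of fun i j => mink (b i) (b j)).det ≠ 0)
    (hta : mink t a = 0) (htb : ∀ i, mink t (b i) = 0) : t = 0 := by
  let M : Matrix (Fin 3) (Fin 3) ℝ := .of ![a, b 0, b 1]
  let J : Matrix (Fin 3) (Fin 3) ℝ := .diagonal ![1, 1, -1]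
  have hG : M * J * M.transpose = !![-1, 0, 0; 0, mink (b 0) (b 0), mink (b 0) (b 1);
      0, mink (b 1) (b 0), mink (b 1) (b 1)] := by
    have h0 := hab 0
    have h1 := hab 1
    ext i j
    rw [Matrix.mul_apply, Fin.sum_univ_three]
    simp only [J, Matrix.mul_diagonal, Matrix.transpose_apply]
    simp only [mink] at ha h0 h1 ⊢
    fin_cases i <;> fin_cases j <;> simp [M] <;> linarith
  -- Taking determinants, `-(det M)² = -det (⟨bᵢ, bⱼ⟩)`.
  have hM : M.det ≠ 0 := by
    intro h0
    have := congrArg Matrix.det hG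
    rw [Matrix.det_mul, Matrix.det_mul, h0, zero_mul, zero_mul, Matrix.det_fin_three] at this
    apply hb
    rw [Matrix.det_fin_two]
    simp at this ⊢
    linarith
  have hMt : M.mulVec ![t 0, t 1, - t 2] = 0 := by
    have h0 := htb 0
    have h1 := htb 1
    ext i
    fin_cases i <;>
      simp [M, Matrix.mulVec, dotProduct, Fin.sum_univ_three, mink] at hta h0 h1 ⊢ <;> linarith
  have h := Matrix.eq_zero_of_mulVec_eq_zero hM hMt
  ext i
  have h0 := congrFun h 0
  have h1 := congrFun h 1
  have h2 := congrFun h 2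
  fin_cases i <;> simp_all

/-- A vector is determined by its products with vectors `a`, `b₀`, `b₁` as in
`eq_zero_of_mink_eq_zero`. -/
theorem eq_of_mink_eq {a s t : R21} {b : Fin 2 → R21} (ha : mink a a = -1)
    (hab : ∀ i, mink a (b i) = 0)
    (hb : (Matrix.of fun i j => mink (b i) (b j)).det ≠ 0)
    (hta : mink s a = mink t a) (htb : ∀ i, mink s (b i) = mink t (b i)) : s = t :=
  sub_eq_zero.1 <| eq_zero_of_mink_eq_zero ha hab hb (by rw [mink_sub_left, hta, sub_self])
    fun i => by rw [mink_sub_left, htb, sub_self]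

/-! ### Partial derivatives of vector valued functions on the plane -/

/-- The `i`-th partial derivative of a function on the plane with values in Minkowski space. -/
def pdVec (i : Fin 2) (F : Plane → R21) (y : Plane) : R21 :=
  fderiv ℝ F y (EuclideanSpace.single i 1)

theorem pdVec_congr {i : Fin 2} {F G : Plane → R21} {y : Plane} (hFG : F =ᶠ[𝓝 y] G) :
    pdVec i F y = pdVec i G y := by
  rw [pdVec, pdVec, hFG.fderiv_eq]

theorem pd_mink {A B : Plane → R21} {y : Plane} (hA : DifferentiableAt ℝ A y)
    (hB : DifferentiableAt ℝ B y) (i : Fin 2) :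
    pd i (fun z => mink (A z) (B z)) y = mink (pdVec i A y) (B y) + mink (A y) (pdVec i B y) := by
  have h : (fun z => mink (A z) (B z)) =
      fun z => pullMink (ContinuousLinearMap.id ℝ R21) (A z) (B z) := by
    funext z; rw [pullMink_apply]; rfl
  rw [pd, h, ((pullMink (ContinuousLinearMap.id ℝ R21)).hasFDerivAt_of_bilinear hA.hasFDerivAt
    hB.hasFDerivAt).fderiv]
  simp [pullMink_apply, pdVec, add_comm]

theorem _root_.ContDiffAt.mink {A B : Plane → R21} {y : Plane} (hA : ContDiffAt ℝ ∞ A y)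
    (hB : ContDiffAt ℝ ∞ B y) : ContDiffAt ℝ ∞ (fun z => HypSurf.mink (A z) (B z)) y := by
  have hA' := contDiffAt_pi.1 hA
  have hB' := contDiffAt_pi.1 hB
  exact (((hA' 0).mul (hB' 0)).add ((hA' 1).mul (hB' 1))).sub ((hA' 2).mul (hB' 2))

theorem contDiffAt_pdVec {F : Plane → R21} {y : Plane} (hF : ContDiffAt ℝ ∞ F y) (i : Fin 2) :
    ContDiffAt ℝ ∞ (pdVec i F) y :=
  (hF.fderiv_right (m := ∞) (by simp)).clm_apply contDiffAt_const

theorem contDiffAt_pd {f : Plane → ℝ} {y : Plane} (hf : ContDiffAt ℝ ∞ f y) (i : Fin 2) :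
    ContDiffAt ℝ ∞ (pd i f) y :=
  (hf.fderiv_right (m := ∞) (by simp)).clm_apply contDiffAt_const

theorem pdVec_pdVec_comm {F : Plane → R21} {y : Plane} (hF : ContDiffAt ℝ ∞ F y) (i j : Fin 2) :
    pdVec i (pdVec j F) y = pdVec j (pdVec i F) y := by
  have hd : DifferentiableAt ℝ (fderiv ℝ F) y :=
    (hF.fderiv_right (m := ∞) (by simp)).differentiableAt (by simp)
  have key (i j : Fin 2) : pdVec i (pdVec j F) y =
      fderiv ℝ (fderiv ℝ F) y (EuclideanSpace.single i 1) (EuclideanSpace.single j 1) := by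
    have h := hd.hasFDerivAt.clm_apply
      (hasFDerivAt_const (EuclideanSpace.single j (1 : ℝ) : Plane) y)
    change fderiv ℝ (fun z => fderiv ℝ F z (EuclideanSpace.single j 1)) y _ = _
    rw [h.fderiv]
    simp
  rw [key, key]
  exact (hF.isSymmSndFDerivAt (by simp; exact WithTop.coe_le_coe.2 le_top)) _ _

theorem pdVec_smul {c : Plane → ℝ} {A : Plane → R21} {y : Plane} (hc : DifferentiableAt ℝ c y)
    (hA : DifferentiableAt ℝ A y) (i : Fin 2) :
    pdVec i (fun z => c z • A z) y = pd i c y • A y + c y • pdVec i A y := by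
  rw [pdVec, (hc.hasFDerivAt.fun_smul hA.hasFDerivAt).fderiv]
  simp [pd, pdVec, add_comm]

theorem pdVec_sub {A B : Plane → R21} {y : Plane} (hA : DifferentiableAt ℝ A y)
    (hB : DifferentiableAt ℝ B y) (i : Fin 2) :
    pdVec i (fun z => A z - B z) y = pdVec i A y - pdVec i B y := by
  rw [pdVec, (hA.hasFDerivAt.fun_sub hB.hasFDerivAt).fderiv]
  simp [pdVec]

theorem pdVec_add {A B : Plane → R21} {y : Plane} (hA : DifferentiableAt ℝ A y)
    (hB : DifferentiableAt ℝ B y) (i : Fin 2) :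
    pdVec i (fun z => A z + B z) y = pdVec i A y + pdVec i B y := by
  rw [pdVec, (hA.hasFDerivAt.fun_add hB.hasFDerivAt).fderiv]
  simp [pdVec]

theorem plane_eq_sum (v : Plane) : v = ∑ i, v i • (EuclideanSpace.single i 1 : Plane) := by
  ext j; fin_cases j <;> simp

/-- A continuous linear map on the plane is given by its values on the standard basis. -/
theorem clm_apply_eq_sum (A : Plane →L[ℝ] R21) (v : Plane) :
    A v = ∑ i, v i • A (EuclideanSpace.single i 1) := by
  conv_lhs => rw [plane_eq_sum v]
  simp

/-! ### A developing map in local coordinates -/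

section Coordinates

variable {S : Type u} [TopologicalSpace S] [ChartedSpace Plane S] [IsManifold (𝓡 2) ∞ S]

/-- In the chart `e`, and over the open set `Ω` of coordinates, the smooth map `F` is a local
isometry for the metric `h` to the hyperboloid in Minkowski space. -/
structure CoordDevelopment (h : Metric S) (e : OpenPartialHomeomorph S Plane) (F : Plane → R21)
    (Ω : Set Plane) : Prop where
  isOpen : IsOpen Ω
  smooth : ∀ y ∈ Ω, ContDiffAt ℝ ∞ F y
  mink_self : ∀ y ∈ Ω, mink (F y) (F y) = -1
  gram_eq : ∀ y ∈ Ω, ∀ i j, gram h e y i j = mink (pdVec i F y) (pdVec j F y)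
  det_ne_zero : ∀ y ∈ Ω, (gram h e y).det ≠ 0

namespace CoordDevelopment

variable {h : Metric S} {e : OpenPartialHomeomorph S Plane} {F : Plane → R21} {Ω : Set Plane}
  (D : CoordDevelopment h e F Ω) {y : Plane}
include D

theorem mink_pdVec (hy : y ∈ Ω) (i : Fin 2) : mink (F y) (pdVec i F y) = 0 := by
  have hF := (D.smooth y hy).differentiableAt (by simp)
  have h1 := pd_mink hF hF i
  have h2 : pd i (fun z => mink (F z) (F z)) y = 0 := by
    rw [pd_congr (g := fun _ => -1)]
    · simp [pd]
    · filter_upwards [D.isOpen.mem_nhds hy] with z hz using D.mink_self z hz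
  rw [h2, mink_comm (pdVec i F y)] at h1
  linarith

/-- Vectors of Minkowski space are determined by their products with `F` and its partial
derivatives. -/
theorem ext (hy : y ∈ Ω) {s t : R21} (h0 : mink s (F y) = mink t (F y))
    (h1 : ∀ i, mink s (pdVec i F y) = mink t (pdVec i F y)) : s = t := by
  refine eq_of_mink_eq (D.mink_self y hy) (D.mink_pdVec hy) ?_ h0 h1
  convert! D.det_ne_zero y hy using 2
  ext i j
  exact (D.gram_eq y hy i j).symm

theorem gram_symm (hy : y ∈ Ω) (i j : Fin 2) : gram h e y i j = gram h e y j i := by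
  rw [D.gram_eq y hy, D.gram_eq y hy, mink_comm]

theorem gram_mul_inv (hy : y ∈ Ω) (k m : Fin 2) :
    ∑ l, gram h e y k l * (gram h e y)⁻¹ l m = if k = m then 1 else 0 := by
  have := Matrix.mul_nonsing_inv (gram h e y) (isUnit_iff_ne_zero.2 (D.det_ne_zero y hy))
  have h2 := congrFun (congrFun this k) m
  rwa [Matrix.mul_apply, Matrix.one_apply] at h2

theorem contDiffAt_gram (hy : y ∈ Ω) (i j : Fin 2) :
    ContDiffAt ℝ ∞ (fun z => gram h e z i j) y := by
  refine ((contDiffAt_pdVec (D.smooth y hy) i).mink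
    (contDiffAt_pdVec (D.smooth y hy) j)).congr_of_eventuallyEq ?_
  filter_upwards [D.isOpen.mem_nhds hy] with z hz using D.gram_eq z hz i j

theorem contDiffAt_gram_inv (hy : y ∈ Ω) (i j : Fin 2) :
    ContDiffAt ℝ ∞ (fun z => (gram h e z)⁻¹ i j) y := by
  have hg := D.contDiffAt_gram hy
  have hdet : ContDiffAt ℝ ∞ (fun z => (gram h e z).det) y := by
    simp only [Matrix.det_fin_two]
    exact ((hg 0 0).mul (hg 1 1)).sub ((hg 0 1).mul (hg 1 0))
  have hinv := hdet.inv (D.det_ne_zero y hy)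
  simp only [Matrix.inv_def, Ring.inverse_eq_inv', Matrix.adjugate_fin_two, Matrix.smul_apply,
    smul_eq_mul]
  refine hinv.mul ?_
  fin_cases i <;> fin_cases j
  · exact hg 1 1
  · exact (hg 0 1).neg
  · exact (hg 1 0).neg
  · exact hg 0 0

theorem mink_sum_pdVec (hy : y ∈ Ω) (X : Fin 2 → ℝ) (m : Fin 2) :
    mink (∑ l, X l • pdVec l F y) (pdVec m F y) = ∑ l, X l * gram h e y l m := by
  simp only [Fin.sum_univ_two, mink_add_left, mink_smul_left, D.gram_eq y hy]

theorem mink_sum_self (hy : y ∈ Ω) (X : Fin 2 → ℝ) :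
    mink (∑ l, X l • pdVec l F y) (F y) = 0 := by
  rw [mink_comm]
  simp [Fin.sum_univ_two, mink_add_right, mink_smul_right, D.mink_pdVec hy]

theorem pd_gram (hy : y ∈ Ω) (i j l : Fin 2) : pd l (fun z => gram h e z i j) y =
    mink (pdVec l (pdVec i F) y) (pdVec j F y) + mink (pdVec l (pdVec j F) y) (pdVec i F y) := by
  have hd (i : Fin 2) := (contDiffAt_pdVec (D.smooth y hy) i).differentiableAt (by simp)
  rw [pd_congr (g := fun z => mink (pdVec i F z) (pdVec j F z)), pd_mink (hd i) (hd j),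
    mink_comm (pdVec i F y)]
  filter_upwards [D.isOpen.mem_nhds hy] with z hz using D.gram_eq z hz i j

theorem christoffel_eq (hy : y ∈ Ω) (i j k : Fin 2) : christoffel h e i j k y =
    ∑ l, (gram h e y)⁻¹ k l * mink (pdVec i (pdVec j F) y) (pdVec l F y) := by
  rw [christoffel, Finset.mul_sum]
  refine Finset.sum_congr rfl fun l _ => ?_
  rw [D.pd_gram hy, D.pd_gram hy, D.pd_gram hy, pdVec_pdVec_comm (D.smooth y hy) l j,
    pdVec_pdVec_comm (D.smooth y hy) l i, pdVec_pdVec_comm (D.smooth y hy) j i]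
  ring

/-- The Gauss formula of the hyperboloid: its normal vector at the point `F` is `F` itself. -/
theorem gauss (hy : y ∈ Ω) (i j : Fin 2) : pdVec i (pdVec j F) y =
    ∑ k, christoffel h e i j k y • pdVec k F y + gram h e y i j • F y := by
  have hF := (D.smooth y hy).differentiableAt (by simp)
  have hd := (contDiffAt_pdVec (D.smooth y hy) j).differentiableAt (by simp)
  refine D.ext hy ?_ fun m => ?_
  · have h1 := pd_mink hF hd i
    rw [pd_congr (g := fun _ => 0)] at h1
    · rw [mink_add_left, D.mink_sum_self hy, mink_smul_left, D.mink_self y hy, D.gram_eq y hy,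
        mink_comm]
      simp only [pd, fderiv_fun_const, Pi.zero_apply, zero_apply] at h1
      linarith
    · filter_upwards [D.isOpen.mem_nhds hy] with z hz using D.mink_pdVec hz j
  · rw [mink_add_left, D.mink_sum_pdVec hy, mink_smul_left, D.mink_pdVec hy]
    simp only [D.christoffel_eq hy]
    have key (l : Fin 2) :
        ∑ k, (gram h e y)⁻¹ k l * gram h e y k m = if m = l then 1 else 0 := by
      rw [← D.gram_mul_inv hy m l]
      exact Finset.sum_congr rfl fun k _ => by rw [D.gram_symm hy k m, mul_comm]
    simp only [Finset.sum_mul]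
    rw [Finset.sum_comm]
    have : ∀ l, ∑ k, (gram h e y)⁻¹ k l * mink (pdVec i (pdVec j F) y) (pdVec l F y) *
        gram h e y k m = mink (pdVec i (pdVec j F) y) (pdVec l F y) * if m = l then 1 else 0 := by
      intro l
      rw [← key l, Finset.mul_sum]
      exact Finset.sum_congr rfl fun k _ => by ring
    simp [this]

/-- The derivative of the tangent vector field `∑ X^l ∂_l F`: its tangential part is the covariant
derivative of `X`. -/
theorem pdVec_sum (hy : y ∈ Ω) {X : Fin 2 → Plane → ℝ} (hX : ∀ l, DifferentiableAt ℝ (X l) y)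
    (i : Fin 2) : pdVec i (fun z => ∑ l, X l z • pdVec l F z) y =
      ∑ k, covDeriv h e i X k y • pdVec k F y + (∑ l, X l y * gram h e y l i) • F y := by
  have hd (l : Fin 2) := (contDiffAt_pdVec (D.smooth y hy) l).differentiableAt (by simp)
  simp only [Fin.sum_univ_two]
  rw [pdVec_add ((hX 0).fun_smul (hd 0)) ((hX 1).fun_smul (hd 1)), pdVec_smul (hX 0) (hd 0),
    pdVec_smul (hX 1) (hd 1), D.gauss hy, D.gauss hy]
  simp only [covDeriv, Fin.sum_univ_two, D.gram_symm hy _ i]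
  module

/-- The coefficients of a tangent vector field depend smoothly on it. -/
theorem contDiffAt_coeff (hy : y ∈ Ω) {X : Fin 2 → Plane → ℝ} {B : Plane → R21}
    (hB : ContDiffAt ℝ ∞ B y) (hXB : ∀ᶠ z in 𝓝 y, B z = ∑ l, X l z • pdVec l F z) (k : Fin 2) :
    ContDiffAt ℝ ∞ (X k) y := by
  have h1 : ContDiffAt ℝ ∞ (fun z => ∑ m, mink (B z) (pdVec m F z) * (gram h e z)⁻¹ m k) y :=
    ContDiffAt.sum fun m _ => (hB.mink (contDiffAt_pdVec (D.smooth y hy) m)).mul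
      (D.contDiffAt_gram_inv hy m k)
  refine h1.congr_of_eventuallyEq ?_
  filter_upwards [hXB, D.isOpen.mem_nhds hy] with z hz hzΩ
  simp only [hz, D.mink_sum_pdVec hzΩ]
  have h0 := D.gram_mul_inv hzΩ 0 k
  have h1 := D.gram_mul_inv hzΩ 1 k
  simp only [Fin.sum_univ_two] at h0 h1 ⊢
  have : X k z = X 0 z * (if (0 : Fin 2) = k then 1 else 0) +
      X 1 z * (if (1 : Fin 2) = k then 1 else 0) := by
    fin_cases k <;> simp
  rw [this, ← h0, ← h1]
  ring

/-- The coefficients of a tangent vector are unique. -/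
theorem coeff_unique (hy : y ∈ Ω) {X Y : Fin 2 → ℝ}
    (hXY : ∑ l, X l • pdVec l F y = ∑ l, Y l • pdVec l F y) : X = Y := by
  have hm (m : Fin 2) : ∑ l, (X l - Y l) * gram h e y l m = 0 := by
    simp only [sub_mul, Finset.sum_sub_distrib]
    rw [← D.mink_sum_pdVec hy, ← D.mink_sum_pdVec hy, hXY, sub_self]
  have := Matrix.eq_zero_of_vecMul_eq_zero (D.det_ne_zero y hy) (v := X - Y)
    (funext fun m => by simpa [Matrix.vecMul, dotProduct] using hm m)
  exact sub_eq_zero.1 this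

/-! ### Support vectors -/

theorem contDiffAt_gradCoord (hy : y ∈ Ω) {u : S → ℝ} (hu : ContDiffAt ℝ ∞ (u ∘ e.symm) y)
    (k : Fin 2) : ContDiffAt ℝ ∞ (gradCoord h e u k) y :=
  ContDiffAt.sum fun l _ => (D.contDiffAt_gram_inv hy k l).mul (contDiffAt_pd hu l)

theorem mink_grad_sub_self (hy : y ∈ Ω) (u : S → ℝ) :
    mink (∑ k, gradCoord h e u k y • pdVec k F y - u (e.symm y) • F y) (F y) = u (e.symm y) := by
  rw [mink_sub_left, D.mink_sum_self hy, mink_smul_left, D.mink_self y hy]; ring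

theorem mink_grad_sub_pdVec (hy : y ∈ Ω) (u : S → ℝ) (m : Fin 2) :
    mink (∑ k, gradCoord h e u k y • pdVec k F y - u (e.symm y) • F y) (pdVec m F y) =
      pd m (u ∘ e.symm) y := by
  rw [mink_sub_left, D.mink_sum_pdVec hy, mink_smul_left, D.mink_pdVec hy]
  simp only [gradCoord]
  have h0 := D.gram_mul_inv hy m 0
  have h1 := D.gram_mul_inv hy m 1
  simp only [Fin.sum_univ_two, D.gram_symm hy m] at h0 h1 ⊢
  have : pd m (u ∘ e.symm) y = (if m = 0 then 1 else 0) * pd 0 (u ∘ e.symm) y +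
      (if m = 1 then 1 else 0) * pd 1 (u ∘ e.symm) y := by
    fin_cases m <;> simp
  rw [this, ← h0, ← h1]
  ring

/-- The vector with products `u` and `∂_j u` with `F` and `∂_j F` is `grad u - u F`. -/
theorem eq_grad_sub (hy : y ∈ Ω) {u : S → ℝ} {t : R21} (h0 : mink t (F y) = u (e.symm y))
    (h1 : ∀ j, mink t (pdVec j F y) = pd j (u ∘ e.symm) y) :
    t = ∑ k, gradCoord h e u k y • pdVec k F y - u (e.symm y) • F y :=
  D.ext hy (by rw [h0, D.mink_grad_sub_self hy]) fun m => by rw [h1, D.mink_grad_sub_pdVec hy]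

/-- The derivative of the vector field `grad u - u F` has the coefficients of `Hess u - u I`. -/
theorem pdVec_grad_sub (hy : y ∈ Ω) {u : S → ℝ} (hu : ContDiffAt ℝ ∞ (u ∘ e.symm) y)
    (j : Fin 2) :
    pdVec j (fun z => ∑ k, gradCoord h e u k z • pdVec k F z - u (e.symm z) • F z) y =
      ∑ k, covDeriv h e j (gradCoord h e u) k y • pdVec k F y - u (e.symm y) • pdVec j F y := by
  have hd (l : Fin 2) := (contDiffAt_pdVec (D.smooth y hy) l).differentiableAt (by simp)
  have hg (l : Fin 2) := (D.contDiffAt_gradCoord hy hu l).differentiableAt (by simp)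
  have hF := (D.smooth y hy).differentiableAt (by simp)
  have hu' : DifferentiableAt ℝ (fun z => u (e.symm z)) y := hu.differentiableAt (by simp)
  rw [pdVec_sub (DifferentiableAt.fun_sum fun l _ => (hg l).fun_smul (hd l)) (hu'.fun_smul hF),
    D.pdVec_sum hy hg, pdVec_smul hu' hF]
  have h1 := D.mink_grad_sub_pdVec hy u j
  rw [mink_sub_left, D.mink_sum_pdVec hy, mink_smul_left, D.mink_pdVec hy, mul_zero, sub_zero] at h1
  rw [h1]
  change _ + pd j (u ∘ e.symm) y • F y - (pd j (u ∘ e.symm) y • F y + _) = _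
  module

/-- The one-form with components `B_j = ∑ b^k_j ∂_k F` is closed if and only if `b` satisfies the
Codazzi equation, the tangential component of the condition, and is self-adjoint, the normal
component. -/
theorem closed_iff (hy : y ∈ Ω) {b : Fin 2 → Fin 2 → Plane → ℝ}
    (hb : ∀ k j, DifferentiableAt ℝ (b k j) y) (i j : Fin 2) :
    pdVec i (fun z => ∑ k, b k j z • pdVec k F z) y =
        pdVec j (fun z => ∑ k, b k i z • pdVec k F z) y ↔
      (∀ k, covDeriv h e i (fun l => b l j) k y = covDeriv h e j (fun l => b l i) k y) ∧
        ∑ l, b l j y * gram h e y l i = ∑ l, b l i y * gram h e y l j := by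
  rw [D.pdVec_sum hy (fun l => hb l j), D.pdVec_sum hy (fun l => hb l i)]
  constructor
  · intro H
    -- The product with `F` isolates the normal component, which is the self-adjointness.
    have h0 := congrArg (fun t => mink t (F y)) H
    simp only [mink_add_left, D.mink_sum_self hy, mink_smul_left, D.mink_self y hy] at h0
    have h0' : ∑ l, b l j y * gram h e y l i = ∑ l, b l i y * gram h e y l j := by linarith
    rw [h0'] at H
    exact ⟨fun k => congrFun (D.coeff_unique hy (add_right_cancel H)) k, h0'⟩
  · rintro ⟨h1, h2⟩
    simp only [h1, h2]

end CoordDevelopment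

end Coordinates

/-! ### Coordinate vectors and coordinate covectors -/

section Frames

variable {S : Type u} [TopologicalSpace S] [ChartedSpace Plane S] [IsManifold (𝓡 2) ∞ S]
  {e : OpenPartialHomeomorph S Plane} {x : S}

theorem mfderiv_chart_coordVec (he : e ∈ atlas Plane S) (hx : x ∈ e.source) (i : Fin 2) :
    mfderiv (𝓡 2) (𝓡 2) e x (coordVec e i x) = (EuclideanSpace.single i 1 : Plane) := by
  let E := (mdifferentiable_of_mem_atlas (I := 𝓡 2) he).mfderiv hx
  have hE : coordVec e i x = E.symm (EuclideanSpace.single i (1 : ℝ) : Plane) :=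
    congrArg (fun A => A (EuclideanSpace.single i (1 : ℝ) : Plane))
      (ContinuousLinearMap.inverse_equiv E)
  rw [hE]
  exact E.apply_symm_apply _

theorem coordVec_eq_mfderiv_symm (he : e ∈ atlas Plane S) (hx : x ∈ e.source) (i : Fin 2) :
    coordVec e i x = mfderiv (𝓡 2) (𝓡 2) e.symm (e x) (EuclideanSpace.single i 1 : Plane) :=
  congrArg (fun A => A (EuclideanSpace.single i (1 : ℝ) : Plane))
    (ContinuousLinearMap.inverse_equiv ((mdifferentiable_of_mem_atlas (I := 𝓡 2) he).mfderiv hx))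

theorem dx_coordVec (he : e ∈ atlas Plane S) (hx : x ∈ e.source) (k j : Fin 2) :
    dx e k x (coordVec e j x) = if k = j then 1 else 0 := by
  have h := congrArg (EuclideanSpace.proj k : Plane →L[ℝ] ℝ) (mfderiv_chart_coordVec he hx j)
  refine h.trans ?_
  simp

theorem eq_sum_coordVec (he : e ∈ atlas Plane S) (hx : x ∈ e.source)
    (v : TangentSpace (𝓡 2) x) : v = ∑ i, dx e i x v • coordVec e i x := by
  apply (mdifferentiable_of_mem_atlas (I := 𝓡 2) he).mfderiv_injective hx
  rw [map_sum]
  simp only [map_smul, mfderiv_chart_coordVec he hx]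
  exact plane_eq_sum _

/-- The coordinate vectors differentiate functions as partial derivatives in the chart. -/
theorem mfderiv_coordVec {G : Type*} [NormedAddCommGroup G] [NormedSpace ℝ G] {f : S → G}
    (hf : MDifferentiableAt (𝓡 2) 𝓘(ℝ, G) f x) (he : e ∈ atlas Plane S) (hx : x ∈ e.source)
    (i : Fin 2) : mfderiv (𝓡 2) 𝓘(ℝ, G) f x (coordVec e i x) =
      fderiv ℝ (f ∘ e.symm) (e x) (EuclideanSpace.single i 1) := by
  have hs := (mdifferentiable_of_mem_atlas (I := 𝓡 2) he).mdifferentiableAt_symm (e.map_source hx)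
  rw [← mfderiv_eq_fderiv, coordVec_eq_mfderiv_symm he hx]
  have h := mfderiv_comp_apply (I := 𝓡 2) (I' := 𝓡 2) (I'' := 𝓘(ℝ, G)) (e x) (g := f)
    (f := e.symm) (by rwa [e.left_inv hx]) hs (EuclideanSpace.single i 1 : Plane)
  refine Eq.trans ?_ h.symm
  rw [e.left_inv hx]

theorem contDiffAt_comp_symm {G : Type*} [NormedAddCommGroup G] [NormedSpace ℝ G] {f : S → G}
    (hf : ContMDiffAt (𝓡 2) 𝓘(ℝ, G) ∞ f x) (he : e ∈ atlas Plane S) (hx : x ∈ e.source) :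
    ContDiffAt ℝ ∞ (f ∘ e.symm) (e x) := by
  have hs := (contMDiffOn_symm_of_mem_maximalAtlas (I := 𝓡 2) (n := ∞)
    (IsManifold.subset_maximalAtlas he)).contMDiffAt (e.open_target.mem_nhds (e.map_source hx))
  refine contMDiffAt_iff_contDiffAt.1 (ContMDiffAt.comp (e x) ?_ hs)
  rwa [e.left_inv hx]

theorem contMDiffAt_of_comp_symm {G : Type*} [NormedAddCommGroup G] [NormedSpace ℝ G]
    {f : S → G} (he : e ∈ atlas Plane S) (hx : x ∈ e.source)
    (hf : ContDiffAt ℝ ∞ (f ∘ e.symm) (e x)) : ContMDiffAt (𝓡 2) 𝓘(ℝ, G) ∞ f x := by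
  have hs := (contMDiffOn_of_mem_maximalAtlas (I := 𝓡 2) (n := ∞)
    (IsManifold.subset_maximalAtlas he)).contMDiffAt (e.open_source.mem_nhds hx)
  refine (ContMDiffAt.comp x (contMDiffAt_iff_contDiffAt.2 hf) hs).congr_of_eventuallyEq ?_
  filter_upwards [e.open_source.mem_nhds hx] with z hz
  simp [e.left_inv hz]

/-- Linear maps on a tangent space agree if they agree on the coordinate vectors. -/
theorem ext_coordVec {G : Type*} [AddCommGroup G] [Module ℝ G] (he : e ∈ atlas Plane S)
    (hx : x ∈ e.source) {A B : TangentSpace (𝓡 2) x →ₗ[ℝ] G}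
    (h : ∀ i, A (coordVec e i x) = B (coordVec e i x)) : A = B := by
  ext v
  rw [eq_sum_coordVec he hx v]
  simp only [map_sum, map_smul, h]

theorem opCoord_apply (he : e ∈ atlas Plane S) (hx : x ∈ e.source)
    (b : ∀ x : S, TangentSpace (𝓡 2) x →L[ℝ] TangentSpace (𝓡 2) x) (j : Fin 2) :
    b x (coordVec e j x) = ∑ k, opCoord e b k j (e x) • coordVec e k x := by
  simp only [opCoord]
  rw [e.left_inv hx]
  exact eq_sum_coordVec he hx _

theorem gram_apply (h : Metric S) (hx : x ∈ e.source) (i j : Fin 2) :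
    gram h e (e x) i j = h.inner x (coordVec e i x) (coordVec e j x) := by
  simp only [gram, Matrix.of_apply]
  rw [e.left_inv hx]

theorem gram_det_ne_zero (h : Metric S) (he : e ∈ atlas Plane S) (hx : x ∈ e.source) :
    (gram h e (e x)).det ≠ 0 := by
  have hne (c : Fin 2 → ℝ) (hc : c ≠ 0) :
      0 < ∑ i, ∑ j, c i * c j * h.inner x (coordVec e i x) (coordVec e j x) := by
    have hv : ∑ i, c i • coordVec e i x ≠ 0 := by
      intro h0
      apply hc
      funext k
      have := congrArg (dx e k x) h0
      fin_cases k <;> simpa [map_sum, dx_coordVec he hx] using this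
    have := h.pos x _ hv
    simp only [Fin.sum_univ_two, map_add, map_smul, add_apply, smul_apply, smul_eq_mul] at this ⊢
    linarith
  set g := fun i j => h.inner x (coordVec e i x) (coordVec e j x) with hg
  have hs : g 1 0 = g 0 1 := h.symm x _ _
  have h1 : 0 < g 1 1 := by
    have := hne ![0, 1] (by intro h0; simpa using congrFun h0 1)
    simpa [Fin.sum_univ_two] using this
  -- The squared length of `g₁₁ ∂₀ - g₀₁ ∂₁` is `g₁₁` times the determinant.
  have h2 := hne ![g 1 1, - g 0 1] (by intro h0; exact h1.ne' (by simpa using congrFun h0 0))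
  have h3 : 0 < g 1 1 * (g 0 0 * g 1 1 - g 0 1 * g 0 1) := by
    change 0 < ∑ i, ∑ j, _ * _ * g i j at h2
    simp only [Fin.sum_univ_two, Matrix.cons_val_zero, Matrix.cons_val_one, hs] at h2
    linarith
  rw [Matrix.det_fin_two]
  simp only [gram_apply h hx]
  change g 0 0 * g 1 1 - g 0 1 * g 1 0 ≠ 0
  rw [hs]
  exact (pos_of_mul_pos_right h3 h1.le).ne'

theorem covDeriv_gradCoord_congr (h : Metric S) {u v : S → ℝ}
    (huv : u =ᶠ[𝓝 x] v) (hx : x ∈ e.source) (j k : Fin 2) :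
    covDeriv h e j (gradCoord h e u) k (e x) = covDeriv h e j (gradCoord h e v) k (e x) := by
  refine covDeriv_congr fun l => ?_
  have h1 : u ∘ e.symm =ᶠ[𝓝 (e x)] v ∘ e.symm := by
    have hc := e.continuousAt_symm (e.map_source hx)
    rw [ContinuousAt, e.left_inv hx] at hc
    exact hc.eventually huv
  filter_upwards [h1.eventuallyEq_nhds] with y hy
  simp only [gradCoord, pd_congr hy]

theorem hessOp_congr (h : Metric S) {u v : S → ℝ} (huv : u =ᶠ[𝓝 x] v) :
    hessOp h u x = hessOp h v x := by
  simp only [hessOp, hess, covDeriv_gradCoord_congr h huv (mem_chart_source Plane x),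
    huv.eq_of_nhds]

theorem hessOp_coordVec (h : Metric S) (u : S → ℝ) (j : Fin 2) :
    hessOp h u x (coordVec (chartAt Plane x) j x) =
      ∑ k, covDeriv h (chartAt Plane x) j (gradCoord h (chartAt Plane x) u) k (chartAt Plane x x) •
        coordVec (chartAt Plane x) k x - u x • coordVec (chartAt Plane x) j x := by
  have hd := dx_coordVec (chart_mem_atlas Plane x) (mem_chart_source Plane x)
  simp only [hessOp, hess, Fin.sum_univ_two, sub_apply, add_apply, smul_apply,
    ContinuousLinearMap.smulRight_apply, hd, ContinuousLinearMap.id_apply]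
  fin_cases j <;> simp

end Frames

/-! ### Local developing maps -/

section LocalDevelopment

variable {S : Type u} [TopologicalSpace S] [ChartedSpace Plane S] [IsManifold (𝓡 2) ∞ S]

/-- Over the open set `W`, the smooth map `f` is a local isometry for the metric `h` to the
hyperboloid in Minkowski space. -/
structure LocalDevelopment (h : Metric S) (f : S → R21) (W : Set S) : Prop where
  isOpen : IsOpen W
  smooth : ContMDiffOn (𝓡 2) 𝓘(ℝ, R21) ∞ f W
  mink_self : ∀ x ∈ W, mink (f x) (f x) = -1
  inner_eq : ∀ x ∈ W, ∀ v w : TangentSpace (𝓡 2) x, h.inner x v w =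
    mink (mfderiv (𝓡 2) 𝓘(ℝ, R21) f x v) (mfderiv (𝓡 2) 𝓘(ℝ, R21) f x w)

/-- The support vector of the function `u` with respect to the developing map `f`: the vector
`grad u - u f` of Minkowski space, whose product with `f` is `u`. It is written in the preferred
chart at `x`; by `LocalDevelopment.support_eq_iff` it does not depend on the chart. -/
def support (h : Metric S) (f : S → R21) (u : S → ℝ) (x : S) : R21 :=
  ∑ k, gradCoord h (chartAt Plane x) u k (chartAt Plane x x) •
    pdVec k (f ∘ (chartAt Plane x).symm) (chartAt Plane x x) - u x • f x

namespace LocalDevelopment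

variable {h : Metric S} {f : S → R21} {W : Set S} {x : S} {u v : S → ℝ}
  {b : ∀ x : S, TangentSpace (𝓡 2) x →L[ℝ] TangentSpace (𝓡 2) x}
  {e : OpenPartialHomeomorph S Plane}

theorem mono (D : LocalDevelopment h f W) {W' : Set S} (hW' : IsOpen W') (hi : W' ⊆ W) :
    LocalDevelopment h f W' :=
  ⟨hW', D.smooth.mono hi, fun x hx => D.mink_self x (hi hx), fun x hx => D.inner_eq x (hi hx)⟩

theorem contMDiffAt (D : LocalDevelopment h f W) (hx : x ∈ W) :
    ContMDiffAt (𝓡 2) 𝓘(ℝ, R21) ∞ f x :=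
  D.smooth.contMDiffAt (D.isOpen.mem_nhds hx)

theorem mdifferentiableAt (D : LocalDevelopment h f W) (hx : x ∈ W) :
    MDifferentiableAt (𝓡 2) 𝓘(ℝ, R21) f x :=
  (D.contMDiffAt hx).mdifferentiableAt (by simp)

theorem mfderiv_injective (D : LocalDevelopment h f W) (hx : x ∈ W) :
    Function.Injective (mfderiv (𝓡 2) 𝓘(ℝ, R21) f x) := by
  refine (injective_iff_map_eq_zero _).2 fun v hv => ?_
  by_contra hne
  have := h.pos x v hne
  rw [D.inner_eq x hx, hv] at this
  exact this.ne' (mink_zero_left _)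

theorem mfderiv_coordVec (D : LocalDevelopment h f W) (hx : x ∈ W) (he : e ∈ atlas Plane S)
    (hxe : x ∈ e.source) (i : Fin 2) :
    mfderiv (𝓡 2) 𝓘(ℝ, R21) f x (coordVec e i x) = pdVec i (f ∘ e.symm) (e x) :=
  HypSurf.mfderiv_coordVec (D.mdifferentiableAt hx) he hxe i

/-- A local developing map in a chart. -/
theorem coord (D : LocalDevelopment h f W) (he : e ∈ atlas Plane S) :
    CoordDevelopment h e (f ∘ e.symm) (e.target ∩ e.symm ⁻¹' W) where
  isOpen := e.isOpen_inter_preimage_symm D.isOpen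
  smooth y hy := by
    have := contDiffAt_comp_symm (D.contMDiffAt hy.2) he (e.map_target hy.1)
    rwa [e.right_inv hy.1] at this
  mink_self y hy := D.mink_self _ hy.2
  gram_eq y hy i j := by
    have hs := e.map_target hy.1
    have h1 := gram_apply h hs i j
    rw [D.inner_eq _ hy.2, D.mfderiv_coordVec hy.2 he hs, D.mfderiv_coordVec hy.2 he hs,
      e.right_inv hy.1] at h1
    exact h1
  det_ne_zero y hy := by
    have := gram_det_ne_zero h he (e.map_target hy.1)
    rwa [e.right_inv hy.1] at this

omit [ChartedSpace Plane S] [IsManifold (𝓡 2) ∞ S] in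
theorem mem_coord (hx : x ∈ W) (hxe : x ∈ e.source) : e x ∈ e.target ∩ e.symm ⁻¹' W :=
  ⟨e.map_source hxe, by rwa [Set.mem_preimage, e.left_inv hxe]⟩

theorem contMDiffAt_fun (D : LocalDevelopment h f W) (hu : ContMDiffOn (𝓡 2) 𝓘(ℝ, ℝ) ∞ u W)
    (hx : x ∈ W) : ContMDiffAt (𝓡 2) 𝓘(ℝ, ℝ) ∞ u x :=
  hu.contMDiffAt (D.isOpen.mem_nhds hx)

/-- The support vector is characterized by its products with `f` and the derivatives of `f`. -/
theorem support_eq_iff (D : LocalDevelopment h f W) (hu : ContMDiffOn (𝓡 2) 𝓘(ℝ, ℝ) ∞ u W)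
    (hx : x ∈ W) (he : e ∈ atlas Plane S) (hxe : x ∈ e.source) {t : R21} :
    support h f u x = t ↔ mink t (f x) = u x ∧
      ∀ j, mink t (pdVec j (f ∘ e.symm) (e x)) = pd j (u ∘ e.symm) (e x) := by
  have hdu := (D.contMDiffAt_fun hu hx).mdifferentiableAt (by simp)
  have hc := chart_mem_atlas Plane x
  have hxc := mem_chart_source Plane x
  have hs := mem_coord hx hxc
  have hu1 {e} (he : e ∈ atlas Plane S) (hxe : x ∈ e.source) (j : Fin 2) :
      mfderiv (𝓡 2) 𝓘(ℝ, ℝ) u x (coordVec e j x) = pd j (u ∘ e.symm) (e x) :=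
    HypSurf.mfderiv_coordVec hdu he hxe j
  -- The second condition says `⟨t, df⟩ = du`, whatever the chart.
  have hlin (t : R21) : (∀ j, mink t (pdVec j (f ∘ e.symm) (e x)) = pd j (u ∘ e.symm) (e x)) ↔
      ∀ j, mink t (pdVec j (f ∘ (chartAt Plane x).symm) (chartAt Plane x x)) =
        pd j (u ∘ (chartAt Plane x).symm) (chartAt Plane x x) := by
    let A : TangentSpace (𝓡 2) x →ₗ[ℝ] ℝ :=
      { toFun v := mink t (mfderiv (𝓡 2) 𝓘(ℝ, R21) f x v)
        map_add' v w := by rw [map_add]; exact mink_add_right _ _ _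
        map_smul' c v := by rw [map_smul]; exact mink_smul_right _ _ _ }
    let B : TangentSpace (𝓡 2) x →ₗ[ℝ] ℝ := (mfderiv (𝓡 2) 𝓘(ℝ, ℝ) u x).toLinearMap
    have key {e} (he : e ∈ atlas Plane S) (hxe : x ∈ e.source) :
        (∀ j, mink t (pdVec j (f ∘ e.symm) (e x)) = pd j (u ∘ e.symm) (e x)) ↔ A = B := by
      refine ⟨fun H => ext_coordVec he hxe fun i => ?_, fun H j => ?_⟩
      · exact (congrArg (mink t) (D.mfderiv_coordVec hx he hxe i)).trans
          ((H i).trans (hu1 he hxe i).symm)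
      · rw [← D.mfderiv_coordVec hx he hxe, ← hu1 he hxe]
        exact LinearMap.congr_fun H _
    rw [key he hxe, key hc hxc]
  have h0 : u x = u ((chartAt Plane x).symm (chartAt Plane x x)) := by
    rw [(chartAt Plane x).left_inv hxc]
  have hf : f x = (f ∘ (chartAt Plane x).symm) (chartAt Plane x x) := by
    rw [Function.comp_apply, (chartAt Plane x).left_inv hxc]
  rw [hlin, support, h0, hf]
  constructor
  · rintro rfl
    exact ⟨(D.coord hc).mink_grad_sub_self hs u, (D.coord hc).mink_grad_sub_pdVec hs u⟩
  · rintro ⟨h1, h2⟩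
    exact ((D.coord hc).eq_grad_sub hs h1 h2).symm

theorem mink_support (D : LocalDevelopment h f W) (hu : ContMDiffOn (𝓡 2) 𝓘(ℝ, ℝ) ∞ u W)
    (hx : x ∈ W) : mink (support h f u x) (f x) = u x :=
  ((D.support_eq_iff hu hx (chart_mem_atlas Plane x) (mem_chart_source Plane x)).1 rfl).1

theorem support_comp_symm (D : LocalDevelopment h f W) (hu : ContMDiffOn (𝓡 2) 𝓘(ℝ, ℝ) ∞ u W)
    (he : e ∈ atlas Plane S) {y : Plane} (hy : y ∈ e.target ∩ e.symm ⁻¹' W) :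
    support h f u (e.symm y) =
      ∑ k, gradCoord h e u k y • pdVec k (f ∘ e.symm) y - u (e.symm y) • (f ∘ e.symm) y := by
  rw [D.support_eq_iff hu hy.2 he (e.map_target hy.1), e.right_inv hy.1]
  exact ⟨(D.coord he).mink_grad_sub_self hy u, (D.coord he).mink_grad_sub_pdVec hy u⟩

theorem contMDiffAt_support (D : LocalDevelopment h f W)
    (hu : ContMDiffOn (𝓡 2) 𝓘(ℝ, ℝ) ∞ u W) (hx : x ∈ W) :
    ContMDiffAt (𝓡 2) 𝓘(ℝ, R21) ∞ (support h f u) x := by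
  have hc := chart_mem_atlas Plane x
  have hxc := mem_chart_source Plane x
  have hs := mem_coord hx hxc
  have D' := D.coord hc
  have hu' := contDiffAt_comp_symm (D.contMDiffAt_fun hu hx) hc hxc
  refine contMDiffAt_of_comp_symm hc hxc ?_
  have h1 : ContDiffAt ℝ ∞ (fun y => ∑ k, gradCoord h (chartAt Plane x) u k y •
      pdVec k (f ∘ (chartAt Plane x).symm) y - u ((chartAt Plane x).symm y) •
        (f ∘ (chartAt Plane x).symm) y) (chartAt Plane x x) :=
    (ContDiffAt.sum fun k _ => (D'.contDiffAt_gradCoord hs hu' k).smul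
      (contDiffAt_pdVec (D'.smooth _ hs) k)).sub (hu'.smul (D'.smooth _ hs))
  refine h1.congr_of_eventuallyEq ?_
  filter_upwards [D'.isOpen.mem_nhds hs] with y hy using D.support_comp_symm hu hc hy

/-- The derivative of the support vector of `u` is the image under `df` of the operator
`Hess u - u I`. -/
theorem mfderiv_support (D : LocalDevelopment h f W) (hu : ContMDiffOn (𝓡 2) 𝓘(ℝ, ℝ) ∞ u W)
    (hx : x ∈ W) (v : TangentSpace (𝓡 2) x) :
    mfderiv (𝓡 2) 𝓘(ℝ, R21) (support h f u) x v =
      mfderiv (𝓡 2) 𝓘(ℝ, R21) f x (hessOp h u x v) := by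
  have hc := chart_mem_atlas Plane x
  have hxc := mem_chart_source Plane x
  have hs := mem_coord hx hxc
  have D' := D.coord hc
  have hu' := contDiffAt_comp_symm (D.contMDiffAt_fun hu hx) hc hxc
  have hT := (D.contMDiffAt_support hu hx).mdifferentiableAt (by simp)
  have key : (mfderiv (𝓡 2) 𝓘(ℝ, R21) (support h f u) x).toLinearMap =
      ((mfderiv (𝓡 2) 𝓘(ℝ, R21) f x).comp (hessOp h u x)).toLinearMap := by
    refine ext_coordVec hc hxc fun j => ?_
    change mfderiv (𝓡 2) 𝓘(ℝ, R21) (support h f u) x (coordVec (chartAt Plane x) j x) =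
      mfderiv (𝓡 2) 𝓘(ℝ, R21) f x (hessOp h u x (coordVec (chartAt Plane x) j x))
    rw [HypSurf.mfderiv_coordVec hT hc hxc, hessOp_coordVec, map_sub, map_sum]
    simp only [map_smul, D.mfderiv_coordVec hx hc hxc]
    have h1 := D'.pdVec_grad_sub hs hu' j
    rw [(chartAt Plane x).left_inv hxc] at h1
    refine Eq.trans ?_ h1
    refine pdVec_congr ?_
    filter_upwards [D'.isOpen.mem_nhds hs] with y hy using D.support_comp_symm hu hc hy
  exact LinearMap.congr_fun key v

/-- An operator whose image under `df` is the derivative of the support vector is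
`Hess u - u I`. -/
theorem hessOp_eq (D : LocalDevelopment h f W) (hu : ContMDiffOn (𝓡 2) 𝓘(ℝ, ℝ) ∞ u W)
    (hx : x ∈ W) {B : TangentSpace (𝓡 2) x →L[ℝ] TangentSpace (𝓡 2) x}
    (he : e ∈ atlas Plane S) (hxe : x ∈ e.source)
    (hB : ∀ j, mfderiv (𝓡 2) 𝓘(ℝ, R21) f x (B (coordVec e j x)) =
      pdVec j (support h f u ∘ e.symm) (e x)) : hessOp h u x = B := by
  have hT := (D.contMDiffAt_support hu hx).mdifferentiableAt (by simp)
  have : (hessOp h u x).toLinearMap = B.toLinearMap := by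
    refine ext_coordVec he hxe fun j => D.mfderiv_injective hx ?_
    refine ((D.mfderiv_support hu hx _).symm.trans ?_).trans (hB j).symm
    exact HypSurf.mfderiv_coordVec hT he hxe j
  exact ContinuousLinearMap.ext fun v => LinearMap.congr_fun this v

theorem pdVec_support (D : LocalDevelopment h f W) (hu : ContMDiffOn (𝓡 2) 𝓘(ℝ, ℝ) ∞ u W)
    (hx : x ∈ W) (he : e ∈ atlas Plane S) (hxe : x ∈ e.source) (j : Fin 2) :
    pdVec j (support h f u ∘ e.symm) (e x) =
      mfderiv (𝓡 2) 𝓘(ℝ, R21) f x (hessOp h u x (coordVec e j x)) := by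
  have hT := (D.contMDiffAt_support hu hx).mdifferentiableAt (by simp)
  exact (HypSurf.mfderiv_coordVec hT he hxe j).symm.trans (D.mfderiv_support hu hx _)

/-- The image of an operator under the derivative of the developing map, in a chart. -/
theorem mfderiv_opCoord (D : LocalDevelopment h f W) (hx : x ∈ W) (he : e ∈ atlas Plane S)
    (hxe : x ∈ e.source) (j : Fin 2) :
    mfderiv (𝓡 2) 𝓘(ℝ, R21) f x (b x (coordVec e j x)) =
      ∑ k, opCoord e b k j (e x) • pdVec k (f ∘ e.symm) (e x) := by
  rw [opCoord_apply he hxe, map_sum]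
  simp only [map_smul, D.mfderiv_coordVec hx he hxe]
  rfl

theorem inner_opCoord (he : e ∈ atlas Plane S) (hxe : x ∈ e.source) (i j : Fin 2) :
    h.inner x (b x (coordVec e j x)) (coordVec e i x) =
      ∑ l, opCoord e b l j (e x) * gram h e (e x) l i := by
  rw [opCoord_apply he hxe]
  simp [gram_apply h hxe]

theorem selfAdjoint_iff (he : e ∈ atlas Plane S) (hxe : x ∈ e.source) :
    (∀ v w, h.inner x (b x v) w = h.inner x v (b x w)) ↔
      ∀ i j, ∑ l, opCoord e b l j (e x) * gram h e (e x) l i =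
        ∑ l, opCoord e b l i (e x) * gram h e (e x) l j := by
  simp only [← inner_opCoord he hxe]
  constructor
  · intro H i j
    rw [H, h.symm]
  · intro H v w
    have hv := eq_sum_coordVec he hxe v
    have hw := eq_sum_coordVec he hxe w
    have H01 := H 0 1
    have H00 (i : Fin 2) := h.symm x (coordVec e i x)
    rw [hv, hw]
    simp only [Fin.sum_univ_two, map_add, map_smul, add_apply, smul_apply, smul_eq_mul]
    rw [h.symm x (coordVec e 0 x) (b x (coordVec e 0 x)),
      h.symm x (coordVec e 0 x) (b x (coordVec e 1 x)),
      h.symm x (coordVec e 1 x) (b x (coordVec e 0 x)),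
      h.symm x (coordVec e 1 x) (b x (coordVec e 1 x)), H01]

/-- Self-adjointness and the Codazzi equation for `b` say that the one-form `df ∘ b` with values
in Minkowski space is closed. -/
theorem isCodazziOn_iff (D : LocalDevelopment h f W)
    (hsm : ∀ e ∈ atlas Plane S, ∀ k j,
      ContDiffOn ℝ ∞ (opCoord e b k j) (e.target ∩ e.symm ⁻¹' W)) :
    IsCodazziOn h W b ↔ ∀ e ∈ atlas Plane S, ∀ y ∈ e.target ∩ e.symm ⁻¹' W, ∀ i j,
      pdVec i (fun z => ∑ k, opCoord e b k j z • pdVec k (f ∘ e.symm) z) y =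
        pdVec j (fun z => ∑ k, opCoord e b k i z • pdVec k (f ∘ e.symm) z) y := by
  have hd {e} (he : e ∈ atlas Plane S) {y : Plane} (hy : y ∈ e.target ∩ e.symm ⁻¹' W) (k j) :
      DifferentiableAt ℝ (opCoord e b k j) y :=
    ((hsm e he k j).contDiffAt ((D.coord he).isOpen.mem_nhds hy)).differentiableAt (by simp)
  constructor
  · intro H e he y hy i j
    refine ((D.coord he).closed_iff hy (hd he hy) i j).2 ⟨H.codazzi e he y hy.1 hy.2 i j, ?_⟩
    have := (selfAdjoint_iff he (e.map_target hy.1)).1 (H.selfAdjoint _ hy.2) i j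
    rwa [e.right_inv hy.1] at this
  · intro H
    refine ⟨hsm, fun x hx => ?_, fun e he y hy hyW i j =>
      (((D.coord he).closed_iff ⟨hy, hyW⟩ (hd he ⟨hy, hyW⟩) i j).1 (H e he y ⟨hy, hyW⟩ i j)).1⟩
    have hc := chart_mem_atlas Plane x
    have hs := mem_coord hx (mem_chart_source Plane x)
    exact (selfAdjoint_iff hc (mem_chart_source Plane x)).2 fun i j =>
      (((D.coord hc).closed_iff hs (hd hc hs) i j).1 (H _ hc _ hs i j)).2

theorem pdVec_support_eventuallyEq (D : LocalDevelopment h f W)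
    (hu : ContMDiffOn (𝓡 2) 𝓘(ℝ, ℝ) ∞ u W) (he : e ∈ atlas Plane S) {y : Plane}
    (hy : y ∈ e.target ∩ e.symm ⁻¹' W) (j : Fin 2) :
    ∀ᶠ z in 𝓝 y, pdVec j (support h f u ∘ e.symm) z =
      ∑ k, opCoord e (hessOp h u) k j z • pdVec k (f ∘ e.symm) z := by
  filter_upwards [(D.coord he).isOpen.mem_nhds hy] with z hz
  have hzs := e.map_target hz.1
  have h1 := D.pdVec_support hu hz.2 he hzs j
  rwa [D.mfderiv_opCoord hz.2 he hzs, e.right_inv hz.1] at h1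

/-- `Hess u - u I` is a self-adjoint Codazzi operator, as its image under `df` is the differential
of the support vector, a closed form. -/
theorem isCodazziOn_hessOp (D : LocalDevelopment h f W)
    (hu : ContMDiffOn (𝓡 2) 𝓘(ℝ, ℝ) ∞ u W) : IsCodazziOn h W (hessOp h u) := by
  have hT {e} (he : e ∈ atlas Plane S) {y : Plane} (hy : y ∈ e.target ∩ e.symm ⁻¹' W) :
      ContDiffAt ℝ ∞ (support h f u ∘ e.symm) y := by
    have := contDiffAt_comp_symm (D.contMDiffAt_support hu hy.2) he (e.map_target hy.1)
    rwa [e.right_inv hy.1] at this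
  rw [D.isCodazziOn_iff]
  · intro e he y hy i j
    have hev (j : Fin 2) := D.pdVec_support_eventuallyEq hu he hy j
    rw [← pdVec_congr (hev i), ← pdVec_congr (hev j)]
    exact pdVec_pdVec_comm (hT he hy) i j
  · intro e he k j y hy
    exact ((D.coord he).contDiffAt_coeff hy (contDiffAt_pdVec (hT he hy) j)
      (D.pdVec_support_eventuallyEq hu he hy j) k).contDiffWithinAt

theorem support_add (D : LocalDevelopment h f W) (hu : ContMDiffOn (𝓡 2) 𝓘(ℝ, ℝ) ∞ u W)
    (hv : ContMDiffOn (𝓡 2) 𝓘(ℝ, ℝ) ∞ v W) (hx : x ∈ W) :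
    support h f (fun z => u z + v z) x = support h f u x + support h f v x := by
  have hc := chart_mem_atlas Plane x
  have hxc := mem_chart_source Plane x
  obtain ⟨h1, h2⟩ := (D.support_eq_iff hu hx hc hxc).1 rfl
  obtain ⟨h3, h4⟩ := (D.support_eq_iff hv hx hc hxc).1 rfl
  have hu' := (contDiffAt_comp_symm (D.contMDiffAt_fun hu hx) hc hxc).differentiableAt (by simp)
  have hv' := (contDiffAt_comp_symm (D.contMDiffAt_fun hv hx) hc hxc).differentiableAt (by simp)
  refine (D.support_eq_iff (hu.add hv) hx hc hxc).2 ⟨by rw [mink_add_left, h1, h3]; rfl, fun j => ?_⟩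
  rw [mink_add_left, h2, h4]
  have := congrArg (fun A => A (EuclideanSpace.single j (1 : ℝ))) (fderiv_add hu' hv')
  exact this.symm

/-- The operator `Hess u - u I` is additive in `u`. -/
theorem hessOp_add (D : LocalDevelopment h f W) (hu : ContMDiffOn (𝓡 2) 𝓘(ℝ, ℝ) ∞ u W)
    (hv : ContMDiffOn (𝓡 2) 𝓘(ℝ, ℝ) ∞ v W) (hx : x ∈ W) :
    hessOp h (fun z => u z + v z) x = hessOp h u x + hessOp h v x := by
  have hc := chart_mem_atlas Plane x
  have hxc := mem_chart_source Plane x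
  have hs := mem_coord hx hxc
  refine D.hessOp_eq (hu.add hv) hx hc hxc fun j => ?_
  rw [add_apply, map_add, ← D.pdVec_support hu hx hc hxc, ← D.pdVec_support hv hx hc hxc]
  have hTu := (contDiffAt_comp_symm (D.contMDiffAt_support hu hx) hc hxc).differentiableAt
    (by simp)
  have hTv := (contDiffAt_comp_symm (D.contMDiffAt_support hv hx) hc hxc).differentiableAt
    (by simp)
  refine (pdVec_add hTu hTv j).symm.trans (pdVec_congr ?_)
  filter_upwards [(D.coord hc).isOpen.mem_nhds hs] with y hy using (D.support_add hu hv hy.2).symm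

/-! ### The kernel of `u ↦ Hess u - u I` -/

theorem contMDiffOn_mink (D : LocalDevelopment h f W) (t : R21) :
    ContMDiffOn (𝓡 2) 𝓘(ℝ, ℝ) ∞ (fun z => mink t (f z)) W := by
  have hl : ContDiff ℝ ∞ fun w : R21 => mink t w := by unfold mink; fun_prop
  exact hl.contMDiff.comp_contMDiffOn D.smooth

/-- The support vector of `⟨t, f⟩` is the constant `t`. -/
theorem support_mink (D : LocalDevelopment h f W) (t : R21) (hx : x ∈ W) :
    support h f (fun z => mink t (f z)) x = t := by
  have hc := chart_mem_atlas Plane x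
  have hxc := mem_chart_source Plane x
  refine (D.support_eq_iff (D.contMDiffOn_mink t) hx hc hxc).2 ⟨rfl, fun j => ?_⟩
  have hF := ((D.coord hc).smooth _ (mem_coord hx hxc)).differentiableAt (by simp)
  have := pd_mink (differentiableAt_const t) hF j
  refine Eq.trans ?_ this.symm
  simp [pdVec, mink]

theorem hessOp_mink (D : LocalDevelopment h f W) (t : R21) (hx : x ∈ W) :
    hessOp h (fun z => mink t (f z)) x = 0 := by
  have hc := chart_mem_atlas Plane x
  have hxc := mem_chart_source Plane x
  refine D.hessOp_eq (D.contMDiffOn_mink t) hx hc hxc fun j => ?_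
  rw [pdVec_congr (G := fun _ => t)]
  · simp [pdVec]
    rfl
  · filter_upwards [(D.coord hc).isOpen.mem_nhds (mem_coord hx hxc)] with y hy
      using D.support_mink t hy.2

/-- A vector is determined by its products with the values of the developing map near a point. -/
theorem eq_of_eventually_mink_eq (D : LocalDevelopment h f W) (hx : x ∈ W) {s t : R21}
    (hst : ∀ᶠ z in 𝓝 x, mink s (f z) = mink t (f z)) : s = t := by
  obtain ⟨W', hW', hW'o, hxW'⟩ := eventually_nhds_iff.1 (hst.and (D.isOpen.mem_nhds hx))
  have D' := D.mono hW'o fun z hz => (hW' z hz).2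
  have hc := chart_mem_atlas Plane x
  have hxc := mem_chart_source Plane x
  rw [← D'.support_mink s hxW', D'.support_eq_iff (D'.contMDiffOn_mink s) hxW' hc hxc]
  obtain ⟨h1, h2⟩ := (D'.support_eq_iff (D'.contMDiffOn_mink t) hxW' hc hxc).1
    (D'.support_mink t hxW')
  refine ⟨((hW' x hxW').1).symm, fun j => (h2 j).trans (pd_congr ?_)⟩
  filter_upwards [(D'.coord hc).isOpen.mem_nhds (mem_coord hxW' hxc)] with y hy
    using (hW' _ hy.2).1.symm

/-- If `Hess u - u I = 0`, the support vector of `u` is locally constant, so that `u` is the product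
of the developing map with a constant vector. -/
theorem exists_eventually_eq_mink (D : LocalDevelopment h f W)
    (hu : ContMDiffOn (𝓡 2) 𝓘(ℝ, ℝ) ∞ u W) (h0 : ∀ z ∈ W, hessOp h u z = 0) (hx : x ∈ W) :
    ∃ t, ∀ᶠ z in 𝓝 x, u z = mink t (f z) := by
  have hc := chart_mem_atlas Plane x
  have hxc := mem_chart_source Plane x
  set e := chartAt Plane x
  obtain ⟨r, hr, hball⟩ := Metric.isOpen_iff.1 (D.coord hc).isOpen _ (mem_coord hx hxc)
  have hT {y} (hy : y ∈ Metric.ball (e x) r) : DifferentiableAt ℝ (support h f u ∘ e.symm) y := by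
    have hy := hball hy
    have := contDiffAt_comp_symm (D.contMDiffAt_support hu hy.2) hc (e.map_target hy.1)
    rw [e.right_inv hy.1] at this
    exact this.differentiableAt (by simp)
  obtain ⟨t, ht⟩ := Metric.isOpen_ball.exists_is_const_of_fderiv_eq_zero (𝕜 := ℝ)
    (convex_ball (e x) r).isPreconnected
    (f := support h f u ∘ e.symm) (fun y hy => (hT hy).differentiableWithinAt) fun y hy => by
      have hy := hball hy
      ext1 v
      rw [clm_apply_eq_sum]
      refine Finset.sum_eq_zero fun j _ => ?_
      have h1 := D.pdVec_support hu hy.2 hc (e.map_target hy.1) j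
      rw [h0 _ hy.2, zero_apply, map_zero, e.right_inv hy.1] at h1
      exact (congrArg (v j • ·) h1).trans (smul_zero (v j))
  refine ⟨t, ?_⟩
  filter_upwards [(e.continuousAt hxc).preimage_mem_nhds (Metric.ball_mem_nhds _ hr),
    e.open_source.mem_nhds hxc, D.isOpen.mem_nhds hx] with z hz hze hzW
  rw [← ht _ hz, Function.comp_apply, e.left_inv hze, D.mink_support hu hzW]

/-! ### Local surjectivity of `u ↦ Hess u - u I` -/

/-- By the Poincaré lemma, locally the closed form `df ∘ b` is the differential of a map `T` to
Minkowski space, which is the support vector of the function `⟨T, f⟩`. -/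
theorem exists_hessOp_eq (D : LocalDevelopment h f W) (hb : IsCodazziOn h W b) (hx : x ∈ W) :
    ∃ (W' : Set S) (u : S → ℝ), IsOpen W' ∧ x ∈ W' ∧ W' ⊆ W ∧
      ContMDiffOn (𝓡 2) 𝓘(ℝ, ℝ) ∞ u W' ∧ ∀ z ∈ W', hessOp h u z = b z := by
  have hc := chart_mem_atlas Plane x
  have hxc := mem_chart_source Plane x
  set e := chartAt Plane x
  have D' := D.coord hc
  obtain ⟨r, hr, hball⟩ := Metric.isOpen_iff.1 D'.isOpen _ (mem_coord hx hxc)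
  let B (j : Fin 2) (y : Plane) : R21 := ∑ k, opCoord e b k j y • pdVec k (f ∘ e.symm) y
  have hB (j : Fin 2) {y} (hy : y ∈ Metric.ball (e x) r) : ContDiffAt ℝ ∞ (B j) y :=
    ContDiffAt.sum fun k _ => ((hb.smooth e hc k j).contDiffAt
      (D'.isOpen.mem_nhds (hball hy))).smul (contDiffAt_pdVec (D'.smooth y (hball hy)) k)
  have hclosed := (D.isCodazziOn_iff hb.smooth).1 hb e hc
  -- The one-form `df ∘ b` in the chart.
  let η (y : Plane) : Plane →L[ℝ] R21 :=
    ∑ j, (EuclideanSpace.proj j : Plane →L[ℝ] ℝ).smulRight (B j y)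
  have hη {y} (hy : y ∈ Metric.ball (e x) r) : ContDiffAt ℝ ∞ η y :=
    ContDiffAt.sum fun j _ => contDiffAt_const.smulRight (hB j hy)
  have hηs (y : Plane) (j : Fin 2) : η y (EuclideanSpace.single j 1) = B j y := by
    fin_cases j <;> simp [η]
  have hη_deriv {y} (hy : y ∈ Metric.ball (e x) r) (v w : Plane) :
      fderiv ℝ η y v w = ∑ i, ∑ j, (v i * w j) • pdVec i (B j) y := by
    have hd := (hη hy).differentiableAt (by simp)
    have hj (i j : Fin 2) : fderiv ℝ η y (EuclideanSpace.single i 1)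
        (EuclideanSpace.single j 1) = pdVec i (B j) y := by
      have h1 := hd.hasFDerivAt.clm_apply
        (hasFDerivAt_const (EuclideanSpace.single j (1 : ℝ) : Plane) y)
      have h2 : B j = fun z => η z (EuclideanSpace.single j 1) := funext fun z => (hηs z j).symm
      rw [h2, pdVec, h1.fderiv]
      simp
    conv_lhs => rw [plane_eq_sum v, map_sum, clm_apply_eq_sum]
    simp only [map_smul, sum_apply, smul_apply, hj, Finset.smul_sum, smul_smul]
    rw [Finset.sum_comm]
    simp only [mul_comm]
  obtain ⟨T, hT⟩ := (convex_ball (e x) r).exists_forall_hasFDerivAt_of_fderiv_symmetric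
    Metric.isOpen_ball
    (fun y hy => ((hη hy).differentiableAt (by simp)).differentiableWithinAt :
      DifferentiableOn ℝ η (Metric.ball (e x) r))
    (fun y hy v w => by
      rw [hη_deriv hy, hη_deriv hy, Finset.sum_comm]
      refine Finset.sum_congr rfl fun i _ => Finset.sum_congr rfl fun j _ => ?_
      rw [hclosed y (hball hy) j i, mul_comm])
  have hTs : ContDiffOn ℝ ∞ T (Metric.ball (e x) r) := by
    rw [contDiffOn_infty_iff_fderiv_of_isOpen Metric.isOpen_ball]
    refine ⟨fun y hy => (hT y hy).differentiableAt.differentiableWithinAt, fun y hy => ?_⟩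
    exact ((hη hy).contDiffWithinAt).congr (fun z hz => (hT z hz).fderiv) (hT y hy).fderiv
  have hTB {y} (hy : y ∈ Metric.ball (e x) r) (j : Fin 2) : pdVec j T y = B j y := by
    rw [pdVec, (hT y hy).fderiv, hηs]
  have hT' {y} (hy : y ∈ Metric.ball (e x) r) : ContDiffAt ℝ ∞ T y :=
    hTs.contDiffAt (Metric.isOpen_ball.mem_nhds hy)
  let W' : Set S := (e.source ∩ e ⁻¹' Metric.ball (e x) r) ∩ W
  have hW' : IsOpen W' := (e.isOpen_inter_preimage Metric.isOpen_ball).inter D.isOpen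
  have DW : LocalDevelopment h f W' := D.mono hW' Set.inter_subset_right
  let u (z : S) : ℝ := mink (T (e z)) (f z)
  have hue {y} (hy : y ∈ Metric.ball (e x) r) :
      u ∘ e.symm =ᶠ[𝓝 y] fun z => mink (T z) ((f ∘ e.symm) z) := by
    filter_upwards [Metric.isOpen_ball.mem_nhds hy] with z hz
    simp only [u, Function.comp_apply, e.right_inv (hball hz).1]
  have hu : ContMDiffOn (𝓡 2) 𝓘(ℝ, ℝ) ∞ u W' := fun z hz => by
    refine (contMDiffAt_of_comp_symm hc hz.1.1 ?_).contMDiffWithinAt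
    exact ((hT' hz.1.2).mink (D'.smooth _ (hball hz.1.2))).congr_of_eventuallyEq (hue hz.1.2)
  have hsupp {z} (hz : z ∈ W') : support h f u z = T (e z) := by
    refine (DW.support_eq_iff hu hz hc hz.1.1).2 ⟨rfl, fun j => ?_⟩
    -- The term `⟨∂_j T, f⟩` of `∂_j u` vanishes, as `∂_j T = df (b ∂_j)` is tangent.
    rw [pd_congr (hue hz.1.2), pd_mink ((hT' hz.1.2).differentiableAt (by simp))
      ((D'.smooth _ (hball hz.1.2)).differentiableAt (by simp)), hTB hz.1.2,
      D'.mink_sum_self (hball hz.1.2), zero_add]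
  refine ⟨W', u, hW', ⟨⟨hxc, Metric.mem_ball_self hr⟩, hx⟩, Set.inter_subset_right, hu,
    fun z hz => DW.hessOp_eq hu hz hc hz.1.1 fun j => ?_⟩
  rw [D.mfderiv_opCoord hz.2 hc hz.1.1, pdVec_congr (G := T), hTB hz.1.2]
  filter_upwards [(DW.coord hc).isOpen.mem_nhds (mem_coord hz hz.1.1)] with y hy
  rw [Function.comp_apply, hsupp hy.2, e.right_inv hy.1]

end LocalDevelopment

end LocalDevelopment

/-! ### Exactness of sequences of sheaves, on sections -/

section Exactness

variable {X : TopCat.{u}} (K : ShortComplex (TopCat.Sheaf AddCommGrpCat.{u} X))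

/-- If on the sections over every open set the first map of a complex of sheaves of abelian groups
is a kernel of the second one, then it is a kernel in the category of sheaves. -/
def kernelForkIsLimit
    (hinj : ∀ U : (Opens X)ᵒᵖ, Function.Injective (K.f.hom.app U))
    (hker : ∀ (U : (Opens X)ᵒᵖ) (s : K.X₂.obj.obj U), K.g.hom.app U s = 0 →
      ∃ t, K.f.hom.app U t = s) :
    Limits.IsLimit (Limits.KernelFork.ofι K.f K.zero) := by
  refine Limits.KernelFork.IsLimit.ofι _ _ (fun {W'} k hk => ?_) (fun {W'} k hk => ?_)
    (fun {W'} k hk m hm => ?_)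
  · have hk' (U) (s : W'.obj.obj U) : K.g.hom.app U (k.hom.app U s) = 0 :=
      congrArg (fun φ : W' ⟶ K.X₃ => φ.hom.app U s) hk
    choose t ht using fun U s => hker U _ (hk' U s)
    refine ⟨{ app U := AddCommGrpCat.ofHom (AddMonoidHom.mk' (t U) fun a b => hinj U ?_),
              naturality U V i := ?_ }⟩
    · rw [map_add, ht, ht, ht, map_add]
    · ext s
      apply hinj V
      refine (ht V _).trans ?_
      have h1 := congrArg (fun φ => φ s) (k.hom.naturality i)
      have h2 := congrArg (fun φ => φ (t U s)) (K.f.hom.naturality i)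
      refine Eq.trans h1 (Eq.trans ?_ h2.symm)
      exact congrArg (K.X₂.obj.map i) (ht U s).symm
  · apply CategoryTheory.Sheaf.hom_ext
    ext U s
    exact (hker U _ (congrArg (fun φ : W' ⟶ K.X₃ => φ.hom.app U s) hk)).choose_spec
  · apply CategoryTheory.Sheaf.hom_ext
    ext U s
    apply hinj U
    exact (congrArg (fun φ : W' ⟶ K.X₂ => φ.hom.app U s) hm).trans
      (hker U _ (congrArg (fun φ : W' ⟶ K.X₃ => φ.hom.app U s) hk)).choose_spec.symm

/-- A complex `0 → A → B → C → 0` of sheaves of abelian groups is exact if on sections `A` is the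
kernel of `B → C`, and if sections of `C` lift locally to `B`. -/
theorem shortExact_of_sections
    (hinj : ∀ U : (Opens X)ᵒᵖ, Function.Injective (K.f.hom.app U))
    (hker : ∀ (U : (Opens X)ᵒᵖ) (s : K.X₂.obj.obj U), K.g.hom.app U s = 0 →
      ∃ t, K.f.hom.app U t = s)
    (hsurj : ∀ (U : Opens X) (s : K.X₃.obj.obj (.op U)), ∀ x ∈ U, ∃ (V : Opens X) (i : V ≤ U),
      x ∈ V ∧ ∃ t, K.g.hom.app (.op V) t = K.X₃.obj.map (homOfLE i).op s) : K.ShortExact where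
  exact := K.exact_of_f_is_kernel (kernelForkIsLimit K hinj hker)
  mono_f := Limits.Fork.IsLimit.mono (kernelForkIsLimit K hinj hker)
  epi_g := by
    rw [← TopCat.Sheaf.isLocallySurjective_iff_epi, TopCat.Presheaf.isLocallySurjective_iff]
    intro U s x hx
    obtain ⟨V, i, hxV, t, ht⟩ := hsurj U s x hx
    exact ⟨V, i, ⟨t, ht⟩, hxV⟩

end Exactness

/-! ### Local developing maps of a hyperbolic structure -/

theorem hypMetric_inner (x : HypPlane) (v w : TangentSpace (𝓡 2) x) :
    hypMetric.inner x v w = mink (mfderiv (𝓡 2) 𝓘(ℝ, R21) HypPlane.incl x v)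
      (mfderiv (𝓡 2) 𝓘(ℝ, R21) HypPlane.incl x w) :=
  pullMink_apply _ _ _

/-- On the hyperbolic plane, the inclusion in Minkowski space is a developing map. -/
theorem localDevelopment_incl : LocalDevelopment hypMetric HypPlane.incl Set.univ where
  isOpen := isOpen_univ
  smooth := HypPlane.contMDiff_incl.contMDiffOn
  mink_self x _ := x.2.1
  inner_eq x _ v w := hypMetric_inner x v w

section

variable {S St : Type u} [TopologicalSpace S] [ChartedSpace Plane S] [IsManifold (𝓡 2) ∞ S]
  [TopologicalSpace St] [ChartedSpace Plane St] {h : Metric S} {p : St → S}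

theorem IsCodazziOn.mono {b : ∀ x : S, TangentSpace (𝓡 2) x →L[ℝ] TangentSpace (𝓡 2) x}
    {U V : Set S} (hb : IsCodazziOn h U b) (hVU : V ⊆ U) : IsCodazziOn h V b where
  smooth e he k j := (hb.smooth e he k j).mono fun _ hy => ⟨hy.1, hVU hy.2⟩
  selfAdjoint x hx := hb.selfAdjoint x (hVU hx)
  codazzi e he y hy hyV := hb.codazzi e he y hy (hVU hyV)

/-- A map which is the identity near `z` preserves the metric at `z`. -/
theorem inner_mfderiv_of_eventuallyEq_id {q : S → S} {z : S} (hq : q =ᶠ[𝓝 z] id)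
    (v w : TangentSpace (𝓡 2) z) :
    h.inner (q z) (mfderiv (𝓡 2) (𝓡 2) q z v) (mfderiv (𝓡 2) (𝓡 2) q z w) = h.inner z v w := by
  have h1 (v : TangentSpace (𝓡 2) z) : mfderiv (𝓡 2) (𝓡 2) q z v = (v : Plane) :=
    (congrArg (fun A : Plane →L[ℝ] Plane => A v) hq.mfderiv_eq).trans
      (congrArg (fun A : Plane →L[ℝ] Plane => A v) (mfderiv_id (I := 𝓡 2) (x := z)))
  have h2 : h.inner (q z) (v : Plane) (w : Plane) = h.inner z v w :=
    congrArg (fun y => (h.inner y : Plane →L[ℝ] Plane →L[ℝ] ℝ) v w) hq.eq_of_nhds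
  rw [← h2]
  exact congrArg₂ (fun a b : Plane => (h.inner (q z) : Plane →L[ℝ] Plane →L[ℝ] ℝ) a b)
    (h1 v) (h1 w)

namespace HyperbolicStructure

variable (D : HyperbolicStructure h p)
include D

/-- The developing map, composed with a local section of the universal covering, is a local
developing map on the surface. -/
theorem exists_localDevelopment (a : St) : ∃ (W : Set S) (s : S → St),
    LocalDevelopment h (fun z => (D.dev (s z)).incl) W ∧ p a ∈ W ∧ ContinuousAt s (p a) ∧
      s (p a) = a ∧ (∀ z ∈ W, p (s z) = z) ∧ ∀ᶠ b in 𝓝 a, s (p b) = b := by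
  have hl := D.isUniversalCovering.isLocalDiffeomorph a
  set s := hl.localInverse
  have hW := hl.localInverse_open_source
  have hs (z) (hz : z ∈ s.source) : ContMDiffAt (𝓡 2) (𝓡 2) ∞ s z :=
    hl.localInverse_contMDiffOn.contMDiffAt (hW.mem_nhds hz)
  have hps (z) (hz : z ∈ s.source) : p ∘ s =ᶠ[𝓝 z] id :=
    Filter.eventuallyEq_of_mem (hW.mem_nhds hz) hl.localInverse_eqOn_right
  refine ⟨s.source, s, ⟨hW, fun z hz => ?_, fun z hz => (D.dev (s z)).2.1, fun z hz v w => ?_⟩,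
    hl.localInverse_mem_source, (hs _ hl.localInverse_mem_source).continuousAt,
    hl.localInverse_left_inv hl.localInverse_mem_target,
    fun z hz => hl.localInverse_right_inv hz, hl.localInverse_eventuallyEq_left⟩
  · exact (HypPlane.contMDiff_incl.contMDiffAt.comp z
      (D.contMDiff_dev.contMDiffAt.comp z (hs z hz))).contMDiffWithinAt
  · have hds := (hs z hz).mdifferentiableAt (by simp)
    have hdd : MDifferentiableAt (𝓡 2) (𝓡 2) D.dev (s z) :=
      D.contMDiff_dev.mdifferentiableAt (by simp)
    have hdi : MDifferentiableAt (𝓡 2) 𝓘(ℝ, R21) HypPlane.incl (D.dev (s z)) :=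
      HypPlane.contMDiff_incl.mdifferentiableAt (by simp)
    have hdp : MDifferentiableAt (𝓡 2) (𝓡 2) p (s z) :=
      D.isUniversalCovering.isLocalDiffeomorph.contMDiff.mdifferentiableAt (by simp)
    have h1 (v : TangentSpace (𝓡 2) z) :
        mfderiv (𝓡 2) 𝓘(ℝ, R21) (fun z => (D.dev (s z)).incl) z v =
          mfderiv (𝓡 2) 𝓘(ℝ, R21) HypPlane.incl (D.dev (s z))
            (mfderiv (𝓡 2) (𝓡 2) D.dev (s z) (mfderiv (𝓡 2) (𝓡 2) s z v)) :=
      (mfderiv_comp_apply (I' := 𝓡 2) z (g := HypPlane.incl) (f := D.dev ∘ s) hdi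
        (hdd.comp z hds) v).trans
        (congrArg _ (mfderiv_comp_apply (I' := 𝓡 2) z (g := D.dev) (f := s) hdd hds v))
    have h2 (v : TangentSpace (𝓡 2) z) := mfderiv_comp_apply (I' := 𝓡 2) z hdp hds v
    rw [h1, h1]
    refine Eq.trans ?_ (hypMetric_inner _ _ _)
    rw [D.isometry, ← inner_mfderiv_of_eventuallyEq_id (h := h) (hps z hz)]
    exact congrArg₂ (fun a b : Plane => (h.inner (p (s z)) : Plane →L[ℝ] Plane →L[ℝ] ℝ) a b)
      (h2 v) (h2 w)

theorem continuous_p : Continuous p := D.isUniversalCovering.isCoveringMap.continuous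

/-- A vector of Minkowski space is determined by its products with the values of the developing
map near a point. -/
theorem eq_of_eventually_mink_dev {a : St} {t t' : R21}
    (ht : ∀ᶠ b in 𝓝 a, mink t (D.dev b).incl = mink t' (D.dev b).incl) : t = t' := by
  obtain ⟨W, s, L, haW, hsc, hsa, -, -⟩ := D.exists_localDevelopment a
  refine L.eq_of_eventually_mink_eq haW ?_
  rw [ContinuousAt, hsa] at hsc
  exact hsc.eventually ht

/-! ### Flat sections -/

theorem fiberMink_devSection {a : St} {x : S} (ha : p a = x) (t : R21) :
    D.fiberMink (D.fiberEquiv a ha t) (D.devSection x) = mink t (D.dev a).incl := by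
  rw [D.devSection_eq ha, D.fiberMink_fiberEquiv]

/-- The product of a flat section with the developing section is locally the product of a constant
vector with the developing map. -/
theorem exists_fiberMink_eq {U : Opens S} {σ : ∀ x : U, D.Fiber x} (hσ : D.flatCondition.pred U σ)
    {x : S} (hx : x ∈ U) : ∃ (W : Set S) (f : S → R21) (t : R21), LocalDevelopment h f W ∧ x ∈ W ∧
      (extend (T := fun _ => ℝ) U fun z => D.fiberMink (σ z) (D.devSection z)) =ᶠ[𝓝 x]
        fun z => mink t (f z) := by
  obtain ⟨a, rfl⟩ := D.isUniversalCovering.surjective x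
  obtain ⟨W, s, L, haW, hsc, hsa, hps, -⟩ := D.exists_localDevelopment a
  obtain ⟨t, ht⟩ := hσ a hx
  refine ⟨W, _, t, L, haW, ?_⟩
  rw [ContinuousAt, hsa] at hsc
  filter_upwards [hsc.eventually ht, L.isOpen.mem_nhds haW, U.isOpen.mem_nhds hx] with z hz hzW hzU
  have key (b : St) (hbz : p b = z)
      (hb : ∀ hb : p b ∈ U, σ ⟨p b, hb⟩ = D.fiberEquiv b rfl t) :
      D.fiberMink (σ ⟨z, hzU⟩) (D.devSection z) = mink t (D.dev b).incl := by
    subst hbz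
    rw [hb hzU, D.fiberMink_devSection]
  rw [extend_of_mem _ hzU]
  exact key (s z) (hps z hzW) hz

/-- The product of a flat section with the developing section is smooth. -/
theorem smooth_fiberMink {U : Opens S} {σ : ∀ x : U, D.Fiber x}
    (hσ : D.flatCondition.pred U σ) :
    (smoothCondition S).pred U fun z => D.fiberMink (σ z) (D.devSection z) := fun x hx => by
  obtain ⟨W, f, t, L, hxW, hf⟩ := D.exists_fiberMink_eq hσ hx
  exact ((L.contMDiffAt_fun (L.contMDiffOn_mink t) hxW).congr_of_eventuallyEq hf).contMDiffWithinAt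

theorem hessOp_fiberMink {U : Opens S} {σ : ∀ x : U, D.Fiber x} (hσ : D.flatCondition.pred U σ)
    {x : S} (hx : x ∈ U) : hessOp h (extend (T := fun _ => ℝ) U fun z =>
      D.fiberMink (σ z) (D.devSection z)) x = 0 := by
  obtain ⟨W, f, t, L, hxW, hf⟩ := D.exists_fiberMink_eq hσ hx
  rw [hessOp_congr h hf, L.hessOp_mink t hxW]

/-- A flat section is determined by its product with the developing section. -/
theorem eq_zero_of_fiberMink_eq_zero {U : Opens S} {σ : ∀ x : U, D.Fiber x}
    (hσ : D.flatCondition.pred U σ)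
    (h0 : ∀ x : U, D.fiberMink (σ x) (D.devSection x) = 0) (x : U) : σ x = 0 := by
  obtain ⟨x, hx⟩ := x
  obtain ⟨a, rfl⟩ := D.isUniversalCovering.surjective x
  obtain ⟨t, ht⟩ := hσ a hx
  have : t = 0 := D.eq_of_eventually_mink_dev (a := a) <| by
    filter_upwards [ht, D.continuous_p.continuousAt.preimage_mem_nhds (U.isOpen.mem_nhds hx)]
      with b hb hbU
    rw [← D.fiberMink_devSection rfl, ← hb hbU, h0, mink_zero_left]
  rw [ht.self_of_nhds hx, this, D.fiberEquiv_zero]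

theorem exists_eventually_eq_mink_dev {U : Opens S} {u : U → ℝ} (hu : (smoothCondition S).pred U u)
    (h0 : ∀ x ∈ U, hessOp h (extend (T := fun _ => ℝ) U u) x = 0) {a : St} (ha : p a ∈ U) :
    ∃ t : R21, ∀ᶠ b in 𝓝 a, ∀ hb : p b ∈ U, u ⟨p b, hb⟩ = mink t (D.dev b).incl := by
  obtain ⟨W, s, L, haW, hsc, hsa, hps, hsp⟩ := D.exists_localDevelopment a
  obtain ⟨t, ht⟩ := (L.mono (L.isOpen.inter U.isOpen)
    Set.inter_subset_left).exists_eventually_eq_mink (hu.mono Set.inter_subset_right)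
      (fun z hz => h0 z hz.2) ⟨haW, ha⟩
  refine ⟨t, ?_⟩
  filter_upwards [D.continuous_p.continuousAt.eventually ht, hsp] with b hb hsb hbU
  rw [← extend_of_mem (T := fun _ => ℝ) u hbU, hb, hsb]

/-- A smooth function `u` with `Hess u - u I = 0` is the product of a flat section with the
developing section. -/
theorem exists_flat_of_hessOp_eq_zero {U : Opens S} {u : U → ℝ}
    (hu : (smoothCondition S).pred U u)
    (h0 : ∀ x ∈ U, hessOp h (extend (T := fun _ => ℝ) U u) x = 0) :
    ∃ σ : ∀ x : U, D.Fiber x, D.flatCondition.pred U σ ∧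
      ∀ x, D.fiberMink (σ x) (D.devSection x) = u x := by
  have hpt (x : U) : p (D.pt x) ∈ U := by rw [D.p_pt]; exact x.2
  choose t ht using fun x : U => D.exists_eventually_eq_mink_dev hu h0 (hpt x)
  refine ⟨fun x => D.fiberEquiv (D.pt x) (D.p_pt x) (t x), fun a ha => ?_, fun x => ?_⟩
  · obtain ⟨t', ht'⟩ := D.exists_eventually_eq_mink_dev hu h0 ha
    refine ⟨t', ?_⟩
    filter_upwards [ht'.eventually_nhds] with b hb hbU
    obtain ⟨α, hα, hα'⟩ := D.exists_fiberEquiv_eq (a := b) rfl (D.p_pt (p b))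
    rw [hα']
    refine congrArg _ (D.eq_of_eventually_mink_dev (a := D.pt (p b)) ?_)
    -- Both vectors represent `u` near `D.pt (p b) = α b`: the second one by equivariance.
    have hc : Filter.Tendsto α.1.symm (𝓝 (D.pt (p b))) (𝓝 b) := by
      have := α.1.symm.continuous.tendsto (α.1 b)
      rwa [α.1.symm_apply_apply, hα] at this
    filter_upwards [ht ⟨p b, hbU⟩, hc.eventually hb,
      D.continuous_p.continuousAt.preimage_mem_nhds (U.isOpen.mem_nhds (hpt ⟨p b, hbU⟩))]
      with c hc1 hc2 hcU
    have hpc : p (α.1.symm c) = p c := by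
      conv_rhs => rw [← α.1.apply_symm_apply c]
      exact (α.2 _).symm
    have hdev : (D.dev c).incl = (D.hol α).1 (D.dev (α.1.symm c)).incl := by
      conv_lhs => rw [← α.1.apply_symm_apply c, D.equivariant]
      rfl
    rw [← hc1 hcU, hdev, (D.hol α).2.1, ← hc2 (by rw [hpc]; exact hcU)]
    exact congrArg u (Subtype.ext hpc.symm)
  · rw [D.fiberMink_devSection, ← (ht x).self_of_nhds (hpt x)]
    exact congrArg u (Subtype.ext (D.p_pt x))

/-! ### The operator `u ↦ Hess u - u I` on sections -/

theorem isCodazziOn_hessOp {U : Opens S} {u : U → ℝ} (hu : (smoothCondition S).pred U u) :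
    IsCodazziOn h U (hessOp h (extend (T := fun _ => ℝ) U u)) := .of_locally fun x hx => by
  obtain ⟨a, rfl⟩ := D.isUniversalCovering.surjective x
  obtain ⟨W, s, L, haW, -⟩ := D.exists_localDevelopment a
  have L' := L.mono (L.isOpen.inter U.isOpen) Set.inter_subset_left
  exact ⟨_, _, L'.isOpen, ⟨haW, hx⟩, fun _ _ => rfl,
    L'.isCodazziOn_hessOp (hu.mono Set.inter_subset_right)⟩

theorem codazziCondition_hessOp {U : Opens S} {u : U → ℝ} (hu : (smoothCondition S).pred U u) :
    (codazziCondition h).pred U fun x => hessOp h (extend (T := fun _ => ℝ) U u) x :=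
  .of_locally fun _ hx => ⟨U, _, U.isOpen, hx, fun _ hz =>
    extend_of_mem (T := fun x : S => TangentSpace (𝓡 2) x →L[ℝ] TangentSpace (𝓡 2) x) _ hz,
    D.isCodazziOn_hessOp hu⟩

theorem hessOp_add {U : Opens S} {u v : U → ℝ} (hu : (smoothCondition S).pred U u)
    (hv : (smoothCondition S).pred U v) {x : S} (hx : x ∈ U) :
    hessOp h (extend (T := fun _ => ℝ) U fun z => u z + v z) x =
      hessOp h (extend (T := fun _ => ℝ) U u) x + hessOp h (extend (T := fun _ => ℝ) U v) x := by
  obtain ⟨a, rfl⟩ := D.isUniversalCovering.surjective x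
  obtain ⟨W, s, L, haW, -⟩ := D.exists_localDevelopment a
  rw [extend_add]
  exact (L.mono (L.isOpen.inter U.isOpen) Set.inter_subset_left).hessOp_add
    (hu.mono Set.inter_subset_right) (hv.mono Set.inter_subset_right) ⟨haW, hx⟩

/-- Locally, every self-adjoint Codazzi operator is of the form `Hess u - u I`. -/
theorem exists_hessOp_eq {U : Opens S}
    {b : ∀ x : U, TangentSpace (𝓡 2) x.1 →L[ℝ] TangentSpace (𝓡 2) x.1}
    (hb : (codazziCondition h).pred U b) {x : S} (hx : x ∈ U) :
    ∃ (V : Opens S) (i : V ≤ U) (u : V → ℝ), x ∈ V ∧ (smoothCondition S).pred V u ∧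
      ∀ z : V, hessOp h (extend (T := fun _ => ℝ) V u) z = b ⟨z, i z.2⟩ := by
  obtain ⟨a, rfl⟩ := D.isUniversalCovering.surjective x
  obtain ⟨W, s, L, haW, -⟩ := D.exists_localDevelopment a
  obtain ⟨V, u, hV, haV, hVW, hu, hub⟩ :=
    (L.mono (L.isOpen.inter U.isOpen) Set.inter_subset_left).exists_hessOp_eq
      (IsCodazziOn.mono hb Set.inter_subset_right) ⟨haW, hx⟩
  have hext (z) (hz : z ∈ V) : extend (T := fun _ => ℝ) ⟨V, hV⟩ (fun z => u z) z = u z :=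
    extend_of_mem (T := fun _ : S => ℝ) (U := ⟨V, hV⟩) _ hz
  refine ⟨⟨V, hV⟩, fun z hz => (hVW hz).2, fun z => u z, haV, hu.congr hext, fun z => ?_⟩
  rw [hessOp_congr h (Filter.eventuallyEq_of_mem (hV.mem_nhds z.2) hext), hub z z.2]
  exact extend_of_mem (T := fun x : S => TangentSpace (𝓡 2) x →L[ℝ] TangentSpace (𝓡 2) x) _ _

end HyperbolicStructure

end

/-! ### Convex subsets of the hyperbolic plane -/

theorem mink_neg_of_hypPlane (x y : HypPlane) : mink x.incl y.incl < 0 := by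
  obtain ⟨v, hv, hv2⟩ := x
  obtain ⟨w, hw, hw2⟩ := y
  change mink v w < 0
  simp only [mink] at hv hw ⊢
  have hpos : 0 < v 2 * w 2 := mul_pos hv2 hw2
  have h1 : (v 0 * w 0 + v 1 * w 1) ^ 2 < (v 2 * w 2) ^ 2 := by
    have hv' : v 2 * v 2 = v 0 * v 0 + v 1 * v 1 + 1 := by linarith
    have hw' : w 2 * w 2 = w 0 * w 0 + w 1 * w 1 + 1 := by linarith
    have : (v 2 * w 2) ^ 2 =
        (v 0 * v 0 + v 1 * v 1 + 1) * (w 0 * w 0 + w 1 * w 1 + 1) := by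
      rw [← hv', ← hw']; ring
    rw [this]
    nlinarith [sq_nonneg (v 0 * w 1 - v 1 * w 0), mul_self_nonneg (v 0), mul_self_nonneg (v 1),
      mul_self_nonneg (w 0), mul_self_nonneg (w 1)]
  linarith [abs_lt_of_sq_lt_sq h1 hpos.le, le_abs_self (v 0 * w 0 + v 1 * w 1)]

/-- Geodesic segments are connected, and so are convex sets. -/
theorem GeodesicallyConvex.isPreconnected {U : Set HypPlane} (hU : GeodesicallyConvex U) :
    IsPreconnected U := by
  refine isPreconnected_of_forall_pair fun x hx y hy => ?_
  -- The segment is the radial projection to the hyperboloid of the affine segment.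
  let q (s : unitInterval) : R21 := (1 - (s : ℝ)) • x.incl + (s : ℝ) • y.incl
  have hxy := mink_neg_of_hypPlane x y
  have hq (s : unitInterval) : 0 < - mink (q s) (q s) := by
    have hx1 : mink x.incl x.incl = -1 := x.2.1
    have hy1 : mink y.incl y.incl = -1 := y.2.1
    have h0 := s.2.1
    have h1 := s.2.2
    simp only [q, mink_add_left, mink_add_right, mink_smul_left, mink_smul_right, hx1, hy1,
      mink_comm y.incl x.incl]
    nlinarith [mul_nonneg (mul_nonneg h0 (sub_nonneg.2 h1)) (neg_nonneg.2 hxy.le),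
      mul_self_nonneg (2 * (s : ℝ) - 1)]
  have hq2 (s : unitInterval) : 0 < q s 2 := by
    have hx2 : 0 < x.incl 2 := x.2.2
    have hy2 : 0 < y.incl 2 := y.2.2
    simp only [q, Pi.add_apply, Pi.smul_apply, smul_eq_mul]
    rcases s.2.1.eq_or_lt with h | h
    · rw [← h]; simpa using hx2
    · exact add_pos_of_nonneg_of_pos (mul_nonneg (sub_nonneg.2 s.2.2) hx2.le) (mul_pos h hy2)
  let N (s : unitInterval) : ℝ := (√(- mink (q s) (q s)))⁻¹
  have hN (s : unitInterval) : 0 < N s := inv_pos.2 (Real.sqrt_pos.2 (hq s))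
  let γ (s : unitInterval) : HypPlane := ⟨N s • q s, by
    have h1 : N s * N s = (- mink (q s) (q s))⁻¹ := by
      simp only [N]
      rw [← mul_inv, Real.mul_self_sqrt (hq s).le]
    rw [mink_smul_left, mink_smul_right, ← mul_assoc, h1]
    rw [inv_neg, neg_mul, inv_mul_cancel₀ (neg_ne_zero.1 (hq s).ne')],
    mul_pos (hN s) (hq2 s)⟩
  have hqc : Continuous q := by fun_prop
  have hγ : Continuous γ := by
    refine Continuous.subtype_mk (Continuous.smul (Continuous.inv₀ ?_ fun s =>
      (Real.sqrt_pos.2 (hq s)).ne') hqc) _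
    have hm : Continuous fun v : R21 => mink v v := by unfold mink; fun_prop
    exact (hm.comp hqc).neg.sqrt
  have hend (s : unitInterval) (z : HypPlane) (hz : q s = z.incl) : γ s = z := by
    have h1 : mink z.incl z.incl = -1 := z.2.1
    refine Subtype.ext ?_
    change N s • q s = z.incl
    simp [N, hz, h1]
  refine ⟨Set.range γ, ?_, ⟨0, hend 0 x (by simp [q])⟩, ⟨1, hend 1 y (by simp [q])⟩,
    isPreconnected_range hγ⟩
  rintro _ ⟨s, rfl⟩
  refine hU x hx y hy (γ s) (N s * (1 - s)) (N s * s)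
    (mul_nonneg (hN s).le (sub_nonneg.2 s.2.2)) (mul_nonneg (hN s).le s.2.1) ?_
  change N s • q s = _
  simp only [q, smul_add, smul_smul]

theorem minkFunction_injective {U : Opens HypPlane} (hU : (U : Set HypPlane).Nonempty) :
    Function.Injective (minkFunction U) := by
  intro t t' htt
  obtain ⟨x, hx⟩ := hU
  refine localDevelopment_incl.eq_of_eventually_mink_eq (Set.mem_univ x) ?_
  filter_upwards [U.isOpen.mem_nhds hx] with z hz using congrFun htt ⟨z, hz⟩

theorem minkFunction_mem_kernelH (U : Opens HypPlane) (t : R21) :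
    minkFunction U t ∈ kernelH hypMetric U := by
  have L := localDevelopment_incl
  have hext {x} (hx : x ∈ U) :
      extend (T := fun _ => ℝ) U (minkFunction U t) =ᶠ[𝓝 x] fun z => mink t z.incl := by
    filter_upwards [U.isOpen.mem_nhds hx] with z hz using extend_of_mem (T := fun _ => ℝ) _ hz
  refine ⟨fun x hx => ?_, fun x hx => ?_⟩
  · exact ((L.contMDiffAt_fun (L.contMDiffOn_mink t)
      (Set.mem_univ x)).congr_of_eventuallyEq (hext hx)).contMDiffWithinAt
  · rw [hessOp_congr _ (hext hx), L.hessOp_mink t (Set.mem_univ x)]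

/-- On a connected open set the locally constant support vector of a function in the kernel is
constant. -/
theorem exists_minkFunction_eq {U : Opens HypPlane} (hU : (U : Set HypPlane).Nonempty)
    (hc : IsPreconnected (U : Set HypPlane)) {u : U → ℝ} (hu : u ∈ kernelH hypMetric U) :
    ∃ t, minkFunction U t = u := by
  have L := localDevelopment_incl.mono U.isOpen (Set.subset_univ _)
  choose t ht using fun x : U => L.exists_eventually_eq_mink hu.1 hu.2 x.2
  have htl : IsLocallyConstant t := (IsLocallyConstant.iff_eventually_eq t).2 fun x => by
    have h1 := continuous_subtype_val.continuousAt.eventually (ht x).eventually_nhds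
    filter_upwards [h1] with z hz
    refine L.eq_of_eventually_mink_eq z.2 ?_
    filter_upwards [hz, ht z] with w hw hw'
    rw [← hw, ← hw']
  have : PreconnectedSpace U := isPreconnected_iff_preconnectedSpace.1 hc
  obtain ⟨x, hx⟩ := hU
  refine ⟨t ⟨x, hx⟩, funext fun z => ?_⟩
  rw [htl.apply_eq_of_preconnectedSpace ⟨x, hx⟩ z]
  exact (ht z).self_of_nhds.symm.trans (extend_of_mem (T := fun _ => ℝ) u z.2)

/-! ### The exact sequence -/

namespace HyperbolicStructure

variable {S St : Type u} [TopologicalSpace S] [ChartedSpace Plane S] [IsManifold (𝓡 2) ∞ S]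
  [TopologicalSpace St] [ChartedSpace Plane St] {h : Metric S} {p : St → S}
  (D : HyperbolicStructure h p)

theorem fiberMink_add_left {x : S} (q r s : D.Fiber x) :
    D.fiberMink (q + r) s = D.fiberMink q s + D.fiberMink r s := by
  obtain ⟨q, rfl⟩ := (D.fiberEquiv (D.pt x) (D.p_pt x)).surjective q
  obtain ⟨r, rfl⟩ := (D.fiberEquiv (D.pt x) (D.p_pt x)).surjective r
  obtain ⟨s, rfl⟩ := (D.fiberEquiv (D.pt x) (D.p_pt x)).surjective s
  rw [← D.fiberEquiv_add]
  simp only [D.fiberMink_fiberEquiv, mink_add_left]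

/-- The morphism of sheaves `σ ↦ ⟨σ, ι⟩`. -/
def pairing : D.flatSections ⟶ smoothFunctions S :=
  ⟨{ app U := AddCommGrpCat.ofHom (AddMonoidHom.mk'
      (fun σ : D.flatCondition.sections U.unop =>
        (⟨fun x => D.fiberMink (σ.1 x) (D.devSection x), D.smooth_fiberMink σ.2⟩ :
          (smoothCondition S).sections U.unop))
      fun _ _ => Subtype.ext (funext fun _ => D.fiberMink_add_left _ _ _))
     naturality _ _ _ := rfl }⟩

/-- The morphism of sheaves `u ↦ Hess u - u I`. -/
def hessMorphism : smoothFunctions S ⟶ codazziOperators h :=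
  ⟨{ app U := AddCommGrpCat.ofHom (AddMonoidHom.mk'
      (fun u : (smoothCondition S).sections U.unop =>
        (⟨fun x => hessOp h (extend U.unop u.1) x, D.codazziCondition_hessOp u.2⟩ :
          (codazziCondition h).sections U.unop))
      fun u v => Subtype.ext (funext fun x => D.hessOp_add u.2 v.2 x.2))
     naturality U V i := by
      ext u
      refine Subtype.ext (funext fun x => hessOp_congr h ?_)
      filter_upwards [V.unop.isOpen.mem_nhds x.2] with z hz
      exact extend_restrict (T := fun _ => ℝ) i.unop.le u.1 hz }⟩

theorem pairing_comp_hessMorphism : D.pairing ≫ D.hessMorphism = 0 := by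
  apply CategoryTheory.Sheaf.hom_ext
  ext U σ
  exact Subtype.ext (funext fun x => D.hessOp_fiberMink σ.2 x.2)

theorem shortExact :
    (ShortComplex.mk D.pairing D.hessMorphism D.pairing_comp_hessMorphism).ShortExact := by
  refine shortExact_of_sections _ (fun U => ?_) (fun U u hu => ?_) fun U b x hx => ?_
  · refine (injective_iff_map_eq_zero _).2 fun σ hσ => ?_
    refine Subtype.ext (funext fun x => D.eq_zero_of_fiberMink_eq_zero σ.2 (fun x => ?_) x)
    exact congrFun (congrArg Subtype.val hσ) x
  · obtain ⟨σ, hσ, hσu⟩ := D.exists_flat_of_hessOp_eq_zero (U := U.unop) u.2 fun x hx =>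
      congrFun (congrArg Subtype.val hu) ⟨x, hx⟩
    exact ⟨⟨σ, hσ⟩, Subtype.ext (funext hσu)⟩
  · obtain ⟨V, i, u, hxV, hu, hub⟩ := D.exists_hessOp_eq b.2 hx
    exact ⟨V, i, hxV, ⟨u, hu⟩, Subtype.ext (funext hub)⟩

end HyperbolicStructure

end HypSurf

end

theorem mainTheorem12 :
    (∀ {S St : Type u} [TopologicalSpace S] [T2Space S] [SecondCountableTopology S]
      [ChartedSpace Plane S] [IsManifold (𝓡 2) ∞ S]
      [TopologicalSpace St] [ChartedSpace Plane St] [IsManifold (𝓡 2) ∞ St]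
      (h : Metric S) (p : St → S) (D : HyperbolicStructure h p),
      ∃ (V : D.flatSections ⟶ smoothFunctions S) (H : smoothFunctions S ⟶ codazziOperators h)
        (hVH : V ≫ H = 0),
        (∀ (U : Opens S) (σ : D.flatCondition.sections U) (x : U),
          (V.hom.app (.op U) σ : (smoothCondition S).sections U).1 x =
            D.fiberMink (σ.1 x) (D.devSection x)) ∧
        (∀ (U : Opens S) (u : (smoothCondition S).sections U) (x : U),
          (H.hom.app (.op U) u : (codazziCondition h).sections U).1 x =
            hessOp h (extend U u.1) x) ∧
        (ShortComplex.mk V H hVH).ShortExact) ∧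
    (∀ U : Opens HypPlane, (U : Set HypPlane).Nonempty → GeodesicallyConvex U →
      kernelH hypMetric U = (LinearMap.range (minkFunction U) : Set (U → ℝ)) ∧
      Function.Injective (minkFunction U) ∧
      Module.finrank ℝ (LinearMap.range (minkFunction U)) = 3) := by
  refine ⟨fun h p D => ⟨D.pairing, D.hessMorphism, D.pairing_comp_hessMorphism,
    fun _ _ _ => rfl, fun _ _ _ => rfl, D.shortExact⟩, fun U hU hconv => ⟨?_, ?_, ?_⟩⟩
  · refine Set.Subset.antisymm (fun u hu => exists_minkFunction_eq hU hconv.isPreconnected hu) ?_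
    rintro _ ⟨t, rfl⟩
    exact minkFunction_mem_kernelH U t
  · exact minkFunction_injective hU
  · rw [LinearMap.finrank_range_of_inj (minkFunction_injective hU), Module.finrank_fin_fun]
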